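/- **Setting.** Let $\mathbb T^d=\mathbb R^d/\mathbb Z^d$ with the quotient Euclidean norm. Let $F_1,\dots,F_m:\mathbb T^d\to\mathbb R$ be smooth, let $(\xi_j)_{j\in\mathbb Z}$ be an i.i.d. sequence of random vectors in $\mathbb R^m$ on a probability space $\Omega$, with density $\rho$, and put $F_j^\omega(x)=\sum_{i=1}^m \xi_j^i(\omega)F_i(x)$. Let $P$ be the law of $F^\omega_0$ in $C^{2+\alpha}(\mathbb T^d)$, where $0<\alpha\le 1$. Assume: * $\int |c|\,\rho(c)\,dc<\infty$, and for every $i$ there are nonnegative $\rho_i\in L^\infty(\mathbb R)$ and $\hat\rho_i\in L^1(\mathbb R^{m-1})$ with $\rho(c)\le\rho_i(c_i)\hat\rho_i(\hat c_i)$ for a.e. $c$, where $\hat c_i$ is $c$ with the coordinate $c_i$ deleted; * at least one of the following holds: (1) for every $y\in\mathbb T^d$ there are $G_y\in\operatorname{supp}P$ with a maximum at $y$ and $\delta>0$ such that $G_y(y)-G_y(x)\ge\delta\|y-x\|^2$ for all $x$; (2) $0\in\operatorname{supp}P$; * $(F_1,\dots,F_m):\mathbb T^d\to\mathbb R^m$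 is an embedding (a homeomorphism onto its image suffices). Fix $b\in\mathbb R^d$. For an absolutely continuous curve $\zeta:[s,t]\to\mathbb T^d$ let $$\mathbb A^{\omega}(\zeta)=\int_s^t\Big(\tfrac12|\dot\zeta(\tau)|^2-b\cdot\dot\zeta(\tau)\Big)d\tau-\sum_{j\in\mathbb Z,\ s\le j<t}F_j^\omega(\zeta(j)),$$ let $A^\omega_{s,t}(x,x')$ be the infimum of $\mathbb A^\omega(\zeta)$ over such curves with $\zeta(s)=x$, $\zeta(t)=x'$, and for $\varphi\in C(\mathbb T^d)$ and integers $m<n$ let $$K_{m,n}\varphi(x)=\min_{y}\{\varphi(y)+A^\omega_{m,n}(y,x)\},\qquad \check K_{m,n}\varphi(x)=\sup_{y}\{\varphi(y)-A^\omega_{m,n}(x,y)\}.$$ A curve $\gamma$ on an interval $I$ is a minimizer if $\mathbb A^\omega(\gamma|_{[s,t]})=A^\omega_{s,t}(\gamma(s),\gamma(t))$ for all $[s,t]\subset I$. It is represented at integer times by $(x_j,v_j)=(\gamma(j),\dot\gamma(j-))$; if $I=[m,n]$, then at the left end $(x_m,v_m)=(\Phi^\omega_m)^{-1}(x_{m+1},v_{m+1})$,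 where $\Phi^\omega_m(x,v)=(x+v-\nabla F^\omega_m(x),\,v-\nabla F^\omega_m(x))$. A *global minimizer* is a minimizer on $I=(-\infty,\infty)$. A minimizer $(y_n,\eta_n)_{n=-N}^{M}$ is a *backward minimizer* for $K_{-N,M}\varphi(y_M)$ if $K_{-N,M}\varphi(y_M)=\varphi(y_{-N})+A^\omega_{-N,M}(y_{-N},y_M)$, and a *forward minimizer* for $\check K_{-N,M}\varphi(y_{-N})$ if $\check K_{-N,M}\varphi(y_{-N})=\varphi(y_M)-A^\omega_{-N,M}(y_{-N},y_M)$. **Proposition 5.2.** Let $\tilde\rho(\omega)$ be a positive random variable. There is an $\mathbb N$-valued random variable $M_0(\omega)$ such that for a.e. $\omega$ there is a unique global minimizer $(x_j^\omega,v_j^\omega)_{j\in\mathbb Z}$, and for all integers $N,M\ge M_0(\omega)$ and all $\varphi\in C(\mathbb T^d)$: 1. every backward minimizer $(y_n,\eta_n)_{n=-N}^{M}$ for $K_{-N,M}\varphi(y_M)$ satisfies $\|y_0-x_0^\omega\|<\tilde\rho(\omega)$; 2. every forward minimizer $(y_n,\eta_n)_{n=-N}^{M}$ for $\check K_{-N,M}\varphi(y_{-N})$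 satisfies $\|y_0-x_0^\omega\|<\tilde\rho(\omega)$. -/

import Mathlib

open MeasureTheory ProbabilityTheory Topology Set
open scoped ENNReal

noncomputable section

namespace KickedHJ

/-- Euclidean space `ℝ^d`. -/
abbrev E (d : ℕ) : Type := EuclideanSpace ℝ (Fin d)

/-- The integer lattice `ℤ^d` inside `ℝ^d`. -/
def lattice (d : ℕ) : AddSubgroup (E d) where
  carrier := {x | ∀ i, ∃ k : ℤ, x i = k}
  zero_mem' := fun _ => ⟨0, by simp⟩
  add_mem' := by
    intro x y hx hy i
    obtain ⟨k, hk⟩ := hx i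
    obtain ⟨l, hl⟩ := hy i
    exact ⟨k + l, by simp [hk, hl]⟩
  neg_mem' := by
    intro x hx i
    obtain ⟨k, hk⟩ := hx i
    exact ⟨-k, by simp [hk]⟩

/-- The torus `𝕋^d = ℝ^d / ℤ^d`, with the quotient topology and the quotient norm
`‖x‖ = inf {‖w‖ : w ∈ ℝ^d represents x}`. -/
abbrev Torus (d : ℕ) : Type := E d ⧸ lattice d

/-- The projection `ℝ^d → 𝕋^d`. -/
def proj {d : ℕ} (w : E d) : Torus d := QuotientAddGroup.mk w

/-- The `ℤ^d`-periodic lift to `ℝ^d` of a function on the torus. -/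
def lift {d : ℕ} (f : Torus d → ℝ) (w : E d) : ℝ := f (proj w)

/-- The gradient of a function on the torus. -/
def grad {d : ℕ} (f : Torus d → ℝ) (x : Torus d) : E d :=
  gradient (fun w : E d => f (x + proj w)) 0

/-! ### Action, Lax-Oleinik operators, minimizers -/

section Action

variable {d : ℕ}

/-- Lifts `g` of absolutely continuous curves `[s, t] → 𝕋^d` of finite kinetic energy (an absolutely
continuous curve whose velocity is not square integrable has action `+∞`). Every absolutely
continuous curve in the torus is the projection of an absolutely continuous curve in `ℝ^d`, and the
velocity does not depend on the lift. -/
def Admissible (s t : ℝ) (g : ℝ → E d) : Prop :=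
  AbsolutelyContinuousOnInterval g s t ∧
    IntervalIntegrable (fun τ => ‖deriv g τ‖ ^ 2) volume s t

/-- The action on `[s, t]` of the curve with lift `g` in the kicked potentials `f j`, `j ∈ ℤ`:
kinetic part minus the sum of the kicks at the integer times `s ≤ j < t`. -/
def action (f : ℤ → Torus d → ℝ) (b : E d) (s t : ℝ) (g : ℝ → E d) : ℝ :=
  (∫ τ in s..t, ((1 / 2) * ‖deriv g τ‖ ^ 2 - inner ℝ b (deriv g τ)))
    - ∑ j ∈ Finset.Ico ⌈s⌉ ⌈t⌉, f j (proj (g j))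

/-- The action function `A_{s,t}(x, x')`. -/
def actionFn (f : ℤ → Torus d → ℝ) (b : E d) (s t : ℝ) (x x' : Torus d) : ℝ :=
  sInf {a : ℝ | ∃ g : ℝ → E d, Admissible s t g ∧ proj (g s) = x ∧ proj (g t) = x' ∧
    a = action f b s t g}

/-- The backward Lax-Oleinik operator `K_{m,n} φ (x) = min_y (φ y + A_{m,n}(y, x))`. -/
def laxK (f : ℤ → Torus d → ℝ) (b : E d) (m n : ℤ) (φ : C(Torus d, ℝ)) (x : Torus d) : ℝ :=
  ⨅ y : Torus d, (φ y + actionFn f b m n y x)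

/-- The forward Lax-Oleinik operator `Ǩ_{m,n} φ (x) = sup_y (φ y - A_{m,n}(x, y))`. -/
def laxKCheck (f : ℤ → Torus d → ℝ) (b : E d) (m n : ℤ) (φ : C(Torus d, ℝ)) (x : Torus d) : ℝ :=
  ⨆ y : Torus d, (φ y - actionFn f b m n x y)

/-- The curve on the interval `I` with lift `g` is a minimizer: on every `[s, t] ⊆ I` its action is
the value of the action function at its endpoints. -/
def IsMinimizingCurve (f : ℤ → Torus d → ℝ) (b : E d) (I : Set ℝ) (g : ℝ → E d) : Prop :=
  ∀ s t : ℝ, s < t → Icc s t ⊆ I →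
    Admissible s t g ∧ action f b s t g = actionFn f b s t (proj (g s)) (proj (g t))

/-- The map `Φ : (x, v) ↦ (x + v - ∇h(x) mod ℤ^d, v - ∇h(x))` given by one kick potential `h`. -/
def kickMap (h : Torus d → ℝ) (z : Torus d × E d) : Torus d × E d :=
  (z.1 + proj (z.2 - grad h z.1), z.2 - grad h z.1)

/-- `(x_j, v_j)`, `m ≤ j ≤ n`, is a minimizer: there is a minimizing curve `γ` on `[m, n]` with
`x_j = γ(j)` for `m ≤ j ≤ n` and `v_j = γ'(j-)` for `m < j ≤ n`; the velocity at the left end is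
given by `(x_m, v_m) = Φ_m⁻¹ (x_{m+1}, v_{m+1})`. Entries outside `[m, n]` are irrelevant. -/
def IsMinimizer (f : ℤ → Torus d → ℝ) (b : E d) (m n : ℤ) (x : ℤ → Torus d) (v : ℤ → E d) :
    Prop :=
  (∃ g : ℝ → E d, IsMinimizingCurve f b (Icc (m : ℝ) n) g ∧
    (∀ j : ℤ, m ≤ j → j ≤ n → x j = proj (g j)) ∧
    (∀ j : ℤ, m < j → j ≤ n → HasDerivWithinAt g (v j) (Iic (j : ℝ)) j)) ∧
  kickMap (f m) (x m, v m) = (x (m + 1), v (m + 1))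

/-- `(x_j, v_j)`, `m ≤ j ≤ n`, is a (backward) minimizer for `K_{m,n} φ (x_n)`. -/
def IsBackwardMinimizerFor (f : ℤ → Torus d → ℝ) (b : E d) (m n : ℤ) (φ : C(Torus d, ℝ))
    (x : ℤ → Torus d) (v : ℤ → E d) : Prop :=
  IsMinimizer f b m n x v ∧
    laxK f b m n φ (x n) = φ (x m) + actionFn f b m n (x m) (x n)

/-- `(x_j, v_j)`, `m ≤ j ≤ n`, is a (forward) minimizer for `Ǩ_{m,n} φ (x_m)`. -/
def IsForwardMinimizerFor (f : ℤ → Torus d → ℝ) (b : E d) (m n : ℤ) (φ : C(Torus d, ℝ))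
    (x : ℤ → Torus d) (v : ℤ → E d) : Prop :=
  IsMinimizer f b m n x v ∧
    laxKCheck f b m n φ (x m) = φ (x n) - actionFn f b m n (x m) (x n)

/-- `(x_j, v_j)`, `j ∈ ℤ`, is a global minimizer: positions and left velocities at the integer
times of a minimizing curve on `(-∞, ∞)`. -/
def IsGlobalMinimizer (f : ℤ → Torus d → ℝ) (b : E d) (x : ℤ → Torus d) (v : ℤ → E d) : Prop :=
  ∃ g : ℝ → E d, IsMinimizingCurve f b univ g ∧
    ∀ j : ℤ, x j = proj (g j) ∧ HasDerivWithinAt g (v j) (Iic (j : ℝ)) j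

end Action

/-! ### The random potentials and the assumptions on them -/

section Random

variable {d M : ℕ} {Ω : Type*} [MeasurableSpace Ω]

/-- The kicks `F_j^ω(x) = ∑ i, ξ_j^i(ω) F_i(x)`. -/
def kick (F : Fin M → Torus d → ℝ) (ξ : ℤ → Ω → Fin M → ℝ) (ω : Ω) (j : ℤ) (x : Torus d) : ℝ :=
  ∑ i, ξ j ω i * F i x

/-- The `C^{2+α}` norm of a `C^2` function on the torus, with values in `[0, ∞]`. -/
def holderNorm (α : ℝ) (f : Torus d → ℝ) : ℝ≥0∞ :=
  (∑ k ∈ Finset.range 3, ⨆ w : E d, ‖iteratedFDeriv ℝ k (lift f) w‖ₑ) +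
    ⨆ (w : E d) (w' : E d) (_ : w ≠ w'),
      ‖iteratedFDeriv ℝ 2 (lift f) w - iteratedFDeriv ℝ 2 (lift f) w'‖ₑ / edist w w' ^ α

/-- `G ∈ supp P` where `P` is the law in `C^{2+α}(𝕋^d)` of the random function `X`: the function `G`
is in `C^{2+α}`, and every ball around it in the `C^{2+α}` norm is charged by `P`. -/
def InSupport (μ : Measure Ω) (α : ℝ) (X : Ω → Torus d → ℝ) (G : Torus d → ℝ) : Prop :=
  (ContDiff ℝ 2 (lift G) ∧ holderNorm α G < ∞) ∧
    ∀ ε : ℝ≥0∞, 0 < ε → 0 < μ {ω | holderNorm α (fun x => X ω x - G x) < ε}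

/-- For every `y` some `G ∈ supp P` has a (quadratically) nondegenerate maximum at `y`. -/
def Assumption1 (μ : Measure Ω) (α : ℝ) (X : Ω → Torus d → ℝ) : Prop :=
  ∀ y : Torus d, ∃ G : Torus d → ℝ, InSupport μ α X G ∧ (∀ x, G x ≤ G y) ∧
    ∃ δ : ℝ, 0 < δ ∧ ∀ x, δ * ‖y - x‖ ^ 2 ≤ G y - G x

/-- `0 ∈ supp P`. -/
def Assumption2 (μ : Measure Ω) (α : ℝ) (X : Ω → Torus d → ℝ) : Prop :=
  InSupport μ α X (fun _ => 0)

/-- The `F_i` are smooth and the `ξ_j`, `j ∈ ℤ`, are i.i.d. vectors with density `r`. -/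
structure Assumption4 (μ : Measure Ω) (F : Fin M → Torus d → ℝ) (ξ : ℤ → Ω → Fin M → ℝ)
    (r : (Fin M → ℝ) → ℝ) : Prop where
  smooth : ∀ i, ContDiff ℝ ((⊤ : ℕ∞) : WithTop ℕ∞) (lift (F i))
  measurable : ∀ j, Measurable (ξ j)
  indep : iIndepFun ξ μ
  density_measurable : Measurable r
  density_nonneg : ∀ c, 0 ≤ r c
  law : ∀ j, μ.map (ξ j) = volume.withDensity (fun c => ENNReal.ofReal (r c))

/-- In addition to the previous assumption: the `ξ_j` have finite mean, and for every `i` the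
density is bounded by a product of a bounded function of `c_i` and an integrable function of the
remaining coordinates. -/
structure Assumption5 (μ : Measure Ω) (F : Fin M → Torus d → ℝ) (ξ : ℤ → Ω → Fin M → ℝ)
    (r : (Fin M → ℝ) → ℝ) : Prop extends Assumption4 μ F ξ r where
  mean : Integrable (fun c : Fin M → ℝ => ‖WithLp.toLp 2 c‖ * r c) volume
  product_bound : ∀ i : Fin M, ∃ (r₁ : ℝ → ℝ) (r₂ : ({k : Fin M // k ≠ i} → ℝ) → ℝ),
    (∀ u, 0 ≤ r₁ u) ∧ (∀ u, 0 ≤ r₂ u) ∧ MemLp r₁ ∞ volume ∧ Integrable r₂ volume ∧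
    ∀ᵐ c : Fin M → ℝ, r c ≤ r₁ (c i) * r₂ (fun k => c k)

end Random

end KickedHJ

end

noncomputable section

namespace KickedHJ

/-! ### Discrete action on a compact group -/

/-! Between kicks an optimal curve is a straight segment, so the problem reduces to discrete paths
`z : ℤ → 𝕋^d` with step cost `½‖z (j+1) - z j - β‖² - f j (z j)`, where `β = proj b`. By
`actionFn_eq_dAct` the continuous action function is the discrete one up to a constant.

The mechanism is loss of memory. Certain finite kick patterns make `dAct` almost a sum `a x + b y`
(`Sep`), so that the far past and the far future affect the present only through an additive
constant. This property survives enlarging the interval (`Sep.extend`). With nondegenerate maxima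
available, the kicks pull all paths onto an orbit `x₀ + jβ`, which costs no kinetic energy
(`exists_sep_pattern_of_maxima`); with small kicks available, a long quiet stretch makes all
endpoints equally cheap (`exists_sep_pattern_of_zero`). By independence and Borel–Cantelli such
patterns occur almost surely on both sides of time `0` with every precision (`ae_exists_sep`).

Hence the cost of passing through `x` at time `0`, normalised by its value at a base point,
converges uniformly. The limit has the form `H x - ∑ i, c i * F i x`, where `c = ξ 0` is independent
of `H` up to additive constants. The minimum over `x` is Lipschitz in `c`, and where it is
differentiable its gradient is `-F x` for every minimizing `x`; since `F` is injective, the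
minimizing point is unique for almost every `c` (`ae_unique_min`). Compactness turns uniqueness into
a condition on a finite window, `Localized`, under which all minimizers over longer intervals are
close at time `0`, whatever their endpoints (`Localized.norm_sub_le`). Since only minimality
matters, the bound is uniform in `φ` and serves backward and forward minimizers alike. Applied at
every integer time and every scale, it gives uniqueness of the positions of a global minimizer; the
velocities follow from the first order condition. -/

/-- The mixed oscillation of the kernel `A` is at most `ε`, i.e. `A x y` is, up to an error of
order `ε`, the sum of a function of `x` and a function of `y`. -/
def Sep {X : Type*} (A : X → X → ℝ) (ε : ℝ) : Prop :=
  ∀ x x' y y', A x y + A x' y' ≤ A x y' + A x' y + ε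

theorem Sep.mono {X : Type*} {A : X → X → ℝ} {ε ε' : ℝ} (h : Sep A ε) (hε : ε ≤ ε') : Sep A ε' :=
  fun x x' y y' => (h x x' y y').trans (by linarith)

section Discrete

variable {X : Type*} [SeminormedAddCommGroup X]

/-- The cost of one step of a path in the kick potentials `f` with drift `β`. -/
def stepCost (f : ℤ → C(X, ℝ)) (β : X) (j : ℤ) (x y : X) : ℝ :=
  1 / 2 * ‖y - x - β‖ ^ 2 - f j x

/-- The cost of a discrete path between the times `m` and `n`. -/
def pathCost (f : ℤ → C(X, ℝ)) (β : X) (m n : ℤ) (z : ℤ → X) : ℝ :=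
  ∑ j ∈ Finset.Ico m n, stepCost f β j (z j) (z (j + 1))

/-- The discrete action function: the least cost of a path from `x` to `y`. -/
def dAct (f : ℤ → C(X, ℝ)) (β : X) (m n : ℤ) (x y : X) : ℝ :=
  sInf (pathCost f β m n '' {z | z m = x ∧ z n = y})

theorem sum_Ico_consecutive_int (h : ℤ → ℝ) {m k n : ℤ} (hmk : m ≤ k) (hkn : k ≤ n) :
    ∑ j ∈ Finset.Ico m n, h j = ∑ j ∈ Finset.Ico m k, h j + ∑ j ∈ Finset.Ico k n, h j := by
  rw [← Finset.Ico_union_Ico_eq_Ico hmk hkn,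
    Finset.sum_union (Finset.Ico_disjoint_Ico_consecutive m k n)]

theorem pathCost_add (f : ℤ → C(X, ℝ)) (β : X) {m k n : ℤ} (hmk : m ≤ k) (hkn : k ≤ n)
    (z : ℤ → X) : pathCost f β m n z = pathCost f β m k z + pathCost f β k n z :=
  sum_Ico_consecutive_int _ hmk hkn

theorem pathCost_succ (f : ℤ → C(X, ℝ)) (β : X) (m : ℤ) (z : ℤ → X) :
    pathCost f β m (m + 1) z = stepCost f β m (z m) (z (m + 1)) := by
  have : Finset.Ico m (m + 1) = {m} := by ext; simp; omega
  simp [pathCost, this]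

theorem pathCost_congr {f f' : ℤ → C(X, ℝ)} {β : X} {m n : ℤ} {z z' : ℤ → X}
    (hf : ∀ j, m ≤ j → j < n → f j = f' j) (hz : ∀ j, m ≤ j → j ≤ n → z j = z' j) :
    pathCost f β m n z = pathCost f' β m n z' := by
  refine Finset.sum_congr rfl fun j hj => ?_
  rw [Finset.mem_Ico] at hj
  rw [stepCost, stepCost, hf j hj.1 hj.2, hz j hj.1 hj.2.le, hz (j + 1) (by omega) (by omega)]

theorem dAct_congr {f f' : ℤ → C(X, ℝ)} {β : X} {m n : ℤ}
    (hf : ∀ j, m ≤ j → j < n → f j = f' j) : dAct f β m n = dAct f' β m n := by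
  have : pathCost f β m n = pathCost f' β m n :=
    funext fun z => pathCost_congr hf fun _ _ _ => rfl
  ext x y
  rw [dAct, dAct, this]

theorem pathCost_shift (f : ℤ → C(X, ℝ)) (β : X) (m n p : ℤ) (z : ℤ → X) :
    pathCost f β (m + p) (n + p) z =
      pathCost (fun j => f (j + p)) β m n (fun j => z (j + p)) := by
  rw [pathCost, ← Finset.map_add_right_Ico, Finset.sum_map]
  refine Finset.sum_congr rfl fun j _ => ?_
  simp [stepCost, add_right_comm]

theorem dAct_shift (f : ℤ → C(X, ℝ)) (β : X) (m n p : ℤ) (x y : X) :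
    dAct f β (m + p) (n + p) x y = dAct (fun j => f (j + p)) β m n x y := by
  rw [dAct, dAct]
  congr 1
  ext a
  constructor
  · rintro ⟨z, ⟨h1, h2⟩, rfl⟩
    exact ⟨fun j => z (j + p), ⟨h1, h2⟩, (pathCost_shift f β m n p z).symm⟩
  · rintro ⟨z, ⟨h1, h2⟩, rfl⟩
    refine ⟨fun j => z (j - p), ⟨by simpa using h1, by simpa using h2⟩, ?_⟩
    rw [pathCost_shift]
    simp

/-- Overwriting the endpoints removes the constraint: the infimum runs over one fixed compact space
of paths, so it is attained and depends continuously on the kicks and the endpoints. -/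
theorem dAct_eq_of_ne (f : ℤ → C(X, ℝ)) (β : X) {m n : ℤ} (hmn : m < n) (x y : X) :
    dAct f β m n x y = sInf ((fun z : ℤ → X =>
      pathCost f β m n (Function.update (Function.update z m x) n y)) '' univ) := by
  rw [dAct]
  congr 1
  ext a
  constructor
  · rintro ⟨z, ⟨rfl, rfl⟩, rfl⟩
    exact ⟨z, mem_univ _, by simp⟩
  · rintro ⟨z, -, rfl⟩
    refine ⟨Function.update (Function.update z m x) n y, ⟨?_, by simp⟩, rfl⟩
    rw [Function.update_of_ne hmn.ne]
    simp

theorem continuous_update_update (m n : ℤ) : Continuous fun q : (X × X) × (ℤ → X) =>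
    Function.update (Function.update q.2 m q.1.1) n q.1.2 := by
  refine continuous_pi fun j => ?_
  by_cases h : j = n
  · subst h
    simpa using continuous_fst.snd
  · by_cases h' : j = m
    · subst h'
      simpa [Function.update_of_ne h] using continuous_fst.fst
    · simp only [Function.update_of_ne h, Function.update_of_ne h']
      exact (continuous_apply j).comp continuous_snd

variable [CompactSpace X]

theorem _root_.Continuous.pathCost {Y : Type*} [TopologicalSpace Y] {f : Y → ℤ → C(X, ℝ)}
    {z : Y → ℤ → X} (hf : Continuous f) (hz : Continuous z) (β : X) (m n : ℤ) :
    Continuous fun y => KickedHJ.pathCost (f y) β m n (z y) := by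
  have h : Continuous fun p : (ℤ → C(X, ℝ)) × (ℤ → X) => KickedHJ.pathCost p.1 β m n p.2 := by
    unfold KickedHJ.pathCost stepCost
    fun_prop
  have h' := Continuous.comp (f := fun y => (f y, z y)) h (hf.prodMk hz)
  simpa only [Function.comp_def] using h'

theorem continuous_dAct (β : X) {m n : ℤ} (hmn : m < n) :
    Continuous fun p : (ℤ → C(X, ℝ)) × X × X => dAct p.1 β m n p.2.1 p.2.2 := by
  simp only [dAct_eq_of_ne _ β hmn]
  refine IsCompact.continuous_sInf (f := fun (p : (ℤ → C(X, ℝ)) × X × X) (z : ℤ → X) =>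
    pathCost p.1 β m n (Function.update (Function.update z m p.2.1) n p.2.2)) isCompact_univ ?_
  have hu : Continuous fun q : ((ℤ → C(X, ℝ)) × X × X) × (ℤ → X) =>
      Function.update (Function.update q.2 m q.1.2.1) n q.1.2.2 :=
    (continuous_update_update m n).comp
      ((continuous_snd.comp continuous_fst).prodMk continuous_snd)
  exact continuous_fst.fst.pathCost hu β m n

theorem dAct_le_pathCost (f : ℤ → C(X, ℝ)) (β : X) (m n : ℤ) (z : ℤ → X) :
    dAct f β m n (z m) (z n) ≤ pathCost f β m n z := by
  refine csInf_le ?_ ⟨z, ⟨rfl, rfl⟩, rfl⟩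
  refine BddBelow.mono (image_subset_range _ _) ?_
  exact (isCompact_range (continuous_const.pathCost continuous_id β m n)).bddBelow

theorem exists_pathCost_eq (f : ℤ → C(X, ℝ)) (β : X) {m n : ℤ} (hmn : m < n) (x y : X) :
    ∃ z : ℤ → X, z m = x ∧ z n = y ∧ pathCost f β m n z = dAct f β m n x y := by
  have hu : Continuous fun z : ℤ → X => Function.update (Function.update z m x) n y :=
    (continuous_update_update m n).comp ((continuous_const (y := (x, y))).prodMk continuous_id)
  have hc : Continuous fun z : ℤ → X =>
      pathCost f β m n (Function.update (Function.update z m x) n y) :=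
    continuous_const.pathCost hu β m n
  obtain ⟨z, -, hz⟩ := isCompact_univ.exists_sInf_image_eq (α := ℝ)
    ⟨fun _ => x, mem_univ _⟩ hc.continuousOn
  refine ⟨Function.update (Function.update z m x) n y, ?_, by simp, ?_⟩
  · rw [Function.update_of_ne hmn.ne]
    simp
  · rw [dAct_eq_of_ne _ _ hmn, hz]

theorem dAct_succ (f : ℤ → C(X, ℝ)) (β : X) (m : ℤ) (x y : X) :
    dAct f β m (m + 1) x y = stepCost f β m x y := by
  obtain ⟨z, rfl, rfl, hz⟩ := exists_pathCost_eq f β (lt_add_one m) x y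
  rw [← hz, pathCost_succ]

theorem dAct_triangle (f : ℤ → C(X, ℝ)) (β : X) {m k n : ℤ} (hmk : m < k) (hkn : k < n)
    (x w y : X) : dAct f β m n x y ≤ dAct f β m k x w + dAct f β k n w y := by
  obtain ⟨z₁, rfl, rfl, h₁⟩ := exists_pathCost_eq f β hmk x w
  obtain ⟨z₂, hw, rfl, h₂⟩ := exists_pathCost_eq f β hkn (z₁ k) y
  rw [← h₁, ← h₂]
  set z : ℤ → X := fun j => if j ≤ k then z₁ j else z₂ j with hz
  have e₁ : pathCost f β m k z = pathCost f β m k z₁ :=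
    pathCost_congr (fun _ _ _ => rfl) fun j _ hj => by simp [hz, hj]
  have e₂ : pathCost f β k n z = pathCost f β k n z₂ :=
    pathCost_congr (fun _ _ _ => rfl) fun j hj _ => by
      rcases hj.eq_or_lt with rfl | hj
      · simp [hz, hw]
      · simp [hz, not_le.2 hj]
  have := dAct_le_pathCost f β m n z
  rw [pathCost_add f β hmk.le hkn.le, e₁, e₂] at this
  simpa [hz, hmk.le, not_le.2 hkn] using this

theorem exists_dAct_split (f : ℤ → C(X, ℝ)) (β : X) {m k n : ℤ} (hmk : m < k) (hkn : k < n)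
    (x y : X) : ∃ w, dAct f β m n x y = dAct f β m k x w + dAct f β k n w y := by
  obtain ⟨z, rfl, rfl, h⟩ := exists_pathCost_eq f β (hmk.trans hkn) x y
  refine ⟨z k, (dAct_triangle f β hmk hkn _ _ _).antisymm ?_⟩
  rw [← h, pathCost_add f β hmk.le hkn.le]
  exact add_le_add (dAct_le_pathCost ..) (dAct_le_pathCost ..)

theorem dAct_le_of_close {f f' : ℤ → C(X, ℝ)} {β : X} {m n : ℤ} (hmn : m < n) {ε : ℝ}
    (h : ∀ j, m ≤ j → j < n → ∀ x, f' j x ≤ f j x + ε) (x y : X) :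
    dAct f β m n x y ≤ dAct f' β m n x y + (n - m) * ε := by
  obtain ⟨z, rfl, rfl, hz⟩ := exists_pathCost_eq f' β hmn x y
  refine (dAct_le_pathCost f β m n z).trans ?_
  rw [← hz]
  have : ((n : ℝ) - m) * ε = ∑ j ∈ Finset.Ico m n, ε := by
    rw [Finset.sum_const, Int.card_Ico, nsmul_eq_mul, ← Int.cast_natCast,
      Int.toNat_of_nonneg (by omega)]
    push_cast
    rfl
  rw [this, pathCost, pathCost, ← Finset.sum_add_distrib]
  refine Finset.sum_le_sum fun j hj => ?_
  rw [Finset.mem_Ico] at hj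
  have := h j hj.1 hj.2 (z j)
  simp only [stepCost]
  linarith

/-- Each of the four kernel values in `Sep` moves by at most `(n - m) * ε`. -/
theorem Sep.of_close {f f' : ℤ → C(X, ℝ)} {β : X} {m n : ℤ} (hmn : m < n) {ε δ : ℝ}
    (h : ∀ j, m ≤ j → j < n → ∀ x, |f j x - f' j x| ≤ ε) (hS : Sep (dAct f' β m n) δ) :
    Sep (dAct f β m n) (δ + 4 * ((n - m) * ε)) := by
  have h₁ := dAct_le_of_close (f := f) (f' := f') (β := β) hmn
    fun j hj hj' x => by linarith [(abs_le.1 (h j hj hj' x)).1]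
  have h₂ := dAct_le_of_close (f := f') (f' := f) (β := β) hmn
    fun j hj hj' x => by linarith [(abs_le.1 (h j hj hj' x)).2]
  intro x x' y y'
  linarith [h₁ x y, h₁ x' y', h₂ x y', h₂ x' y, hS x x' y y']

/-- Cut the two optimal paths at time `k` and exchange their tails: only the kernel on `[k, n]` is
rearranged, so the cost of the exchange is at most `ε`. -/
theorem Sep.extend_left {f : ℤ → C(X, ℝ)} {β : X} {m k n : ℤ} (hmk : m ≤ k) (hkn : k < n) {ε : ℝ}
    (h : Sep (dAct f β k n) ε) : Sep (dAct f β m n) ε := by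
  rcases hmk.eq_or_lt with rfl | hmk
  · exact h
  intro x x' y y'
  obtain ⟨w, hw⟩ := exists_dAct_split f β hmk hkn x y'
  obtain ⟨w', hw'⟩ := exists_dAct_split f β hmk hkn x' y
  linarith [dAct_triangle f β hmk hkn x w y, dAct_triangle f β hmk hkn x' w' y', h w w' y y']

theorem Sep.extend_right {f : ℤ → C(X, ℝ)} {β : X} {m k n : ℤ} (hmk : m < k) (hkn : k ≤ n) {ε : ℝ}
    (h : Sep (dAct f β m k) ε) : Sep (dAct f β m n) ε := by
  rcases hkn.eq_or_lt with rfl | hkn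
  · exact h
  intro x x' y y'
  obtain ⟨w, hw⟩ := exists_dAct_split f β hmk hkn x y'
  obtain ⟨w', hw'⟩ := exists_dAct_split f β hmk hkn x' y
  linarith [dAct_triangle f β hmk hkn x w' y, dAct_triangle f β hmk hkn x' w y', h x x' w' w]

theorem Sep.extend {f : ℤ → C(X, ℝ)} {β : X} {m p q n : ℤ} (hmp : m ≤ p) (hpq : p < q)
    (hqn : q ≤ n) {ε : ℝ} (h : Sep (dAct f β p q) ε) : Sep (dAct f β m n) ε :=
  (h.extend_right hpq hqn).extend_left hmp (hpq.trans_le hqn)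

/-- Loss of memory: as functions of the right endpoint, the actions from `p` at time `m` and from
`w` at time `k` agree up to a constant and an error `ε`. The path from `p` is cut at its position at
time `k`. -/
theorem dAct_sub_le_of_sep_left {f : ℤ → C(X, ℝ)} {β : X} {m k n : ℤ} (hmk : m ≤ k) (hkn : k < n)
    {ε : ℝ} (h : Sep (dAct f β k n) ε) (p w x x' : X) :
    dAct f β m n p x + dAct f β k n w x' ≤ dAct f β m n p x' + dAct f β k n w x + ε := by
  rcases hmk.eq_or_lt with rfl | hmk
  · exact h _ _ _ _
  obtain ⟨u, hu⟩ := exists_dAct_split f β hmk hkn p x'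
  linarith [dAct_triangle f β hmk hkn p u x, h u w x x']

theorem dAct_sub_le_of_sep_right {f : ℤ → C(X, ℝ)} {β : X} {m k n : ℤ} (hmk : m < k) (hkn : k ≤ n)
    {ε : ℝ} (h : Sep (dAct f β m k) ε) (p w x x' : X) :
    dAct f β m n x p + dAct f β m k x' w ≤ dAct f β m n x' p + dAct f β m k x w + ε := by
  rcases hkn.eq_or_lt with rfl | hkn
  · linarith [h x x' p w]
  obtain ⟨u, hu⟩ := exists_dAct_split f β hmk hkn x' p
  linarith [dAct_triangle f β hmk hkn x u p, h x x' u w]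

end Discrete

/-! ### Localization of minimizers at time `0` -/

section Localization

variable {X : Type*} [SeminormedAddCommGroup X]

/-- The action through `x` at time `0` of the best path on `[-(n+1), n+1]` with both ends at `0`. -/
def throughAct (f : ℤ → C(X, ℝ)) (β : X) (n : ℕ) (x : X) : ℝ :=
  dAct f β (-(n + 1)) 0 0 x + dAct f β 0 (n + 1) x 0

/-- The kicks on `[-(n+1), n+1]` confine all minimizers at time `0` to a set of diameter `≤ r`. -/
def Localized (f : ℤ → C(X, ℝ)) (β : X) (n : ℕ) (r : ℝ) : Prop :=
  ∃ q ε : ℚ, Sep (dAct f β (-(n + 1)) 0) ε ∧ Sep (dAct f β 0 (n + 1)) ε ∧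
    (∃ z, throughAct f β n z < q) ∧
    ∀ x y, ‖x - y‖ ≤ r ∨ (q + 2 * ε : ℝ) ≤ max (throughAct f β n x) (throughAct f β n y)

theorem Localized.mono {f : ℤ → C(X, ℝ)} {β : X} {n : ℕ} {r r' : ℝ} (h : Localized f β n r)
    (hr : r ≤ r') : Localized f β n r' := by
  obtain ⟨q, ε, h₁, h₂, h₃, h₄⟩ := h
  exact ⟨q, ε, h₁, h₂, h₃, fun x y => (h₄ x y).imp_left fun h => h.trans hr⟩

theorem update_dAct_left (f : ℤ → C(X, ℝ)) (β : X) (m : ℤ) (φ : C(X, ℝ)) :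
    dAct (Function.update f 0 φ) β m 0 = dAct f β m 0 :=
  dAct_congr fun _ _ hj => Function.update_of_ne hj.ne _ _

variable [CompactSpace X]

/-- The kick at time `0` enters a path cost only through the initial position, so changing it adds a
function of `x` alone. -/
theorem update_dAct_right (f : ℤ → C(X, ℝ)) (β : X) {n : ℤ} (hn : 0 < n) (φ : C(X, ℝ)) (x y : X) :
    dAct (Function.update f 0 φ) β 0 n x y = dAct f β 0 n x y + f 0 x - φ x := by
  have key : ∀ z : ℤ → X, pathCost (Function.update f 0 φ) β 0 n z =
      pathCost f β 0 n z + f 0 (z 0) - φ (z 0) := fun z => by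
    rw [pathCost_add _ _ zero_le_one (by omega : 1 ≤ n),
      pathCost_add f _ zero_le_one (by omega : 1 ≤ n),
      pathCost_congr (f := Function.update f 0 φ) (f' := f) (m := 1) (z' := z)
        (fun j hj _ => Function.update_of_ne (by omega) _ _) (fun _ _ _ => rfl)]
    have h₁ := pathCost_succ (Function.update f 0 φ) β 0 z
    have h₂ := pathCost_succ f β 0 z
    rw [zero_add] at h₁ h₂
    rw [h₁, h₂]
    simp [stepCost]
    ring
  obtain ⟨z, hx, hy, hz⟩ := exists_pathCost_eq f β hn x y
  obtain ⟨w, hx', hy', hw⟩ := exists_pathCost_eq (Function.update f 0 φ) β hn x y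
  have h₁ := dAct_le_pathCost f β 0 n w
  have h₂ := dAct_le_pathCost (Function.update f 0 φ) β 0 n z
  rw [key, hx, hy] at h₂
  rw [key, hx'] at hw
  rw [hx', hy'] at h₁
  linarith

theorem throughAct_update (f : ℤ → C(X, ℝ)) (β : X) (n : ℕ) (φ : C(X, ℝ)) (x : X) :
    throughAct (Function.update f 0 φ) β n x = throughAct f β n x + f 0 x - φ x := by
  rw [throughAct, throughAct, update_dAct_left, update_dAct_right _ _ (by omega)]
  ring

theorem _root_.Continuous.dAct {Y : Type*} [TopologicalSpace Y] {f : Y → ℤ → C(X, ℝ)}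
    {x y : Y → X} (hf : Continuous f) (hx : Continuous x) (hy : Continuous y) (β : X) {m n : ℤ}
    (hmn : m < n) : Continuous fun s => KickedHJ.dAct (f s) β m n (x s) (y s) := by
  have h := Continuous.comp (f := fun s => (f s, x s, y s)) (continuous_dAct β hmn)
    (hf.prodMk (hx.prodMk hy))
  simpa only [Function.comp_def] using h

theorem _root_.Continuous.throughAct {Y : Type*} [TopologicalSpace Y] {f : Y → ℤ → C(X, ℝ)}
    {x : Y → X} (hf : Continuous f) (hx : Continuous x) (β : X) (n : ℕ) :
    Continuous fun s => KickedHJ.throughAct (f s) β n (x s) :=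
  (hf.dAct continuous_const hx β (by omega)).add (hf.dAct hx continuous_const β (by omega))

/-- Separation on each side replaces the true endpoints by the reference endpoint `0` at a cost of
`ε` per side. A minimizer therefore beats the test point `z` up to `2 * ε`, which puts it in the
sublevel set `throughAct < q + 2 * ε`; two points of that set are within `r`. -/
theorem Localized.norm_sub_le {f : ℤ → C(X, ℝ)} {β : X} {n : ℕ} {r : ℝ} (h : Localized f β n r)
    {m₁ n₁ m₂ n₂ : ℤ} (hm₁ : m₁ ≤ -(n + 1)) (hn₁ : n + 1 ≤ n₁) (hm₂ : m₂ ≤ -(n + 1))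
    (hn₂ : n + 1 ≤ n₂) {y₁ y₂ a₁ b₁ a₂ b₂ : X}
    (h₁ : ∀ x, dAct f β m₁ 0 a₁ y₁ + dAct f β 0 n₁ y₁ b₁ ≤
      dAct f β m₁ 0 a₁ x + dAct f β 0 n₁ x b₁)
    (h₂ : ∀ x, dAct f β m₂ 0 a₂ y₂ + dAct f β 0 n₂ y₂ b₂ ≤
      dAct f β m₂ 0 a₂ x + dAct f β 0 n₂ x b₂) : ‖y₁ - y₂‖ ≤ r := by
  obtain ⟨q, ε, hS, hS', ⟨z, hz⟩, hsep⟩ := h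
  have key : ∀ {m n' : ℤ} {y a b : X}, m ≤ -(n + 1) → n + 1 ≤ n' →
      (∀ x, dAct f β m 0 a y + dAct f β 0 n' y b ≤ dAct f β m 0 a x + dAct f β 0 n' x b) →
      throughAct f β n y < q + 2 * ε := by
    intro m n' y a b hm hn hy
    have e₁ := dAct_sub_le_of_sep_left hm (by omega) hS a 0 z y
    have e₂ := dAct_sub_le_of_sep_right (by omega) hn hS' b 0 z y
    have := hy z
    unfold throughAct at hz ⊢
    linarith
  refine (hsep y₁ y₂).resolve_right fun h => ?_
  rcases le_max_iff.1 h with h | h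
  · exact absurd h (not_le.2 (key hm₁ hn₁ h₁))
  · exact absurd h (not_le.2 (key hm₂ hn₂ h₂))

theorem isClosed_sep (β : X) {m n : ℤ} (hmn : m < n) (ε : ℝ) :
    IsClosed {f : ℤ → C(X, ℝ) | Sep (dAct f β m n) ε} := by
  have hc : ∀ x y : X, Continuous fun f : ℤ → C(X, ℝ) => dAct f β m n x y := fun x y =>
    continuous_id.dAct continuous_const continuous_const β hmn
  simp only [Sep, ofPred_forall]
  refine isClosed_iInter fun x => isClosed_iInter fun x' => isClosed_iInter fun y =>
    isClosed_iInter fun y' => ?_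
  exact isClosed_le ((hc _ _).add (hc _ _)) (((hc _ _).add (hc _ _)).add continuous_const)

/-- This is why `Localized` has rational parameters: the union over `q` and `ε` is countable, and
the uncountable quantifiers over points give intersections of closed sets or unions of open ones.
Measurability is joint in the radius because the radius will be random. -/
theorem measurableSet_localized {S : Type*} [TopologicalSpace S] [SecondCountableTopology S]
    [MeasurableSpace S] [BorelSpace S] {f : S → ℤ → C(X, ℝ)} (hf : Continuous f) (β : X) (n : ℕ) :
    MeasurableSet {p : S × ℝ | Localized (f p.1) β n p.2} := by
  have hc : ∀ x : X, Continuous fun p : S × ℝ => throughAct (f p.1) β n x := fun x =>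
    (hf.comp continuous_fst).throughAct continuous_const β n
  simp only [Localized, ofPred_exists, ofPred_and]
  refine MeasurableSet.iUnion fun q => MeasurableSet.iUnion fun ε => ?_
  refine MeasurableSet.inter ?_ (MeasurableSet.inter ?_ (MeasurableSet.inter ?_ ?_))
  · exact ((isClosed_sep β (by omega) ε).preimage (hf.comp continuous_fst)).measurableSet
  · exact ((isClosed_sep β (by omega) ε).preimage (hf.comp continuous_fst)).measurableSet
  · exact (isOpen_iUnion fun x => isOpen_lt (hc x) continuous_const).measurableSet
  · simp only [ofPred_forall]
    refine (isClosed_iInter fun x => isClosed_iInter fun y => ?_).measurableSet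
    exact (isClosed_le continuous_const continuous_snd).union
      (isClosed_le continuous_const ((hc x).max (hc y)))

/-- Once both sides nearly separate, lengthening the window changes the profile only by a constant
and a small error. Subtracting the value at `0` removes the constant and leaves a uniformly Cauchy
sequence. -/
theorem exists_limit_throughAct {f : ℤ → C(X, ℝ)} {β : X}
    (hl : ∀ ε > 0, ∃ n : ℕ, Sep (dAct f β (-(n + 1)) 0) ε)
    (hr : ∀ ε > 0, ∃ n : ℕ, Sep (dAct f β 0 (n + 1)) ε) :
    ∃ h : C(X, ℝ), ∀ ε > 0, ∃ N : ℕ, ∀ n ≥ N, ∀ x,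
      |throughAct f β n x - throughAct f β n 0 - h x| ≤ ε := by
  have hc : ∀ n, Continuous fun x => throughAct f β n x - throughAct f β n 0 := fun n =>
    (continuous_const.throughAct continuous_id β n).sub continuous_const
  let g : ℕ → C(X, ℝ) := fun n => ⟨_, hc n⟩
  have hg : CauchySeq g := by
    refine Metric.cauchySeq_iff'.2 fun ε hε => ?_
    obtain ⟨n₁, h₁⟩ := hl (ε / 4) (by positivity)
    obtain ⟨n₂, h₂⟩ := hr (ε / 4) (by positivity)
    refine ⟨max n₁ n₂, fun n hn => ?_⟩
    have h₁' := Sep.extend_left (m := -((max n₁ n₂ : ℕ) + 1)) (by omega) (by omega) h₁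
    have h₂' := Sep.extend_right (n := (max n₁ n₂ : ℕ) + 1) (by omega) (by omega) h₂
    have key : ∀ x y, throughAct f β n x - throughAct f β n y -
        (throughAct f β (max n₁ n₂) x - throughAct f β (max n₁ n₂) y) ≤ ε / 2 := fun x y => by
      have e₁ := dAct_sub_le_of_sep_left (m := -(n + 1)) (by omega) (by omega) h₁' 0 0 x y
      have e₂ := dAct_sub_le_of_sep_right (n := n + 1) (by omega) (by omega) h₂' 0 0 x y
      unfold throughAct
      linarith
    refine lt_of_le_of_lt ?_ (half_lt_self hε)
    refine (ContinuousMap.dist_le (by positivity)).2 fun x => ?_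
    rw [Real.dist_eq, abs_le]
    have := key x 0
    have := key 0 x
    constructor <;> simp only [g, ContinuousMap.coe_mk] <;> linarith
  obtain ⟨h, hh⟩ := cauchySeq_tendsto_of_complete hg
  refine ⟨h, fun ε hε => ?_⟩
  obtain ⟨N, hN⟩ := Metric.tendsto_atTop.1 hh ε hε
  refine ⟨N, fun n hn x => ?_⟩
  have := (ContinuousMap.dist_apply_le_dist x).trans (hN n hn).le
  rwa [Real.dist_eq] at this

/-- On the compact set of pairs at distance at least `r`, `max (h x) (h y)` attains its minimum,
which exceeds `min h` because otherwise both points would be minimizers. -/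
theorem exists_gap_of_unique_min {h : X → ℝ} (hc : Continuous h)
    (huniq : ∀ x y, (∀ z, h x ≤ h z) → (∀ z, h y ≤ h z) → x = y) {r : ℝ} (hr : 0 < r) :
    ∃ x₀, ∃ γ > 0, ∀ x y, ‖x - y‖ ≤ r ∨ h x₀ + γ ≤ max (h x) (h y) := by
  obtain ⟨x₀, -, hx₀⟩ := isCompact_univ.exists_isMinOn (univ_nonempty (α := X)) hc.continuousOn
  have hx₀' : ∀ z, h x₀ ≤ h z := fun z => hx₀ (mem_univ z)
  let K : Set (X × X) := {p | r ≤ ‖p.1 - p.2‖}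
  have hK : IsClosed K := isClosed_le continuous_const (continuous_fst.sub continuous_snd).norm
  rcases K.eq_empty_or_nonempty with hK0 | hK0
  · refine ⟨x₀, 1, one_pos, fun x y => Or.inl ?_⟩
    by_contra! hxy
    have : (x, y) ∈ K := hxy.le
    simp [hK0] at this
  · obtain ⟨⟨x₁, y₁⟩, h₁, hmin⟩ := hK.isCompact.exists_isMinOn hK0
      ((hc.comp continuous_fst).max (hc.comp continuous_snd)).continuousOn
    refine ⟨x₀, max (h x₁) (h y₁) - h x₀, ?_, fun x y => ?_⟩
    · by_contra! hle
      have hx : h x₁ ≤ h x₀ := (le_max_left _ _).trans (by linarith)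
      have hy : h y₁ ≤ h x₀ := (le_max_right _ _).trans (by linarith)
      have := huniq x₁ y₁ (fun z => hx.trans (hx₀' z)) fun z => hy.trans (hx₀' z)
      subst this
      have : r ≤ ‖x₁ - x₁‖ := h₁
      simp at this
      linarith
    · rcases le_total ‖x - y‖ r with hxy | hxy
      · exact Or.inl hxy
      · refine Or.inr ?_
        have : max (h x₁) (h y₁) ≤ max (h x) (h y) := hmin (show (x, y) ∈ K from hxy)
        linarith

theorem exists_localized_of_unique_min {f : ℤ → C(X, ℝ)} {β : X} {h : C(X, ℝ)}
    (hl : ∀ ε > 0, ∃ n : ℕ, Sep (dAct f β (-(n + 1)) 0) ε)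
    (hr : ∀ ε > 0, ∃ n : ℕ, Sep (dAct f β 0 (n + 1)) ε)
    (hh : ∀ ε > 0, ∃ N : ℕ, ∀ n ≥ N, ∀ x,
      |throughAct f β n x - throughAct f β n 0 - h x| ≤ ε)
    (huniq : ∀ x y, (∀ z, h x ≤ h z) → (∀ z, h y ≤ h z) → x = y) {r : ℝ} (hr0 : 0 < r) :
    ∃ n, Localized f β n r := by
  obtain ⟨x₀, γ, hγ, hgap⟩ := exists_gap_of_unique_min h.continuous huniq hr0
  obtain ⟨ε, hε0, hε⟩ := exists_rat_btwn (show (0 : ℝ) < γ / 8 by positivity)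
  obtain ⟨n₁, h₁⟩ := hl ε hε0
  obtain ⟨n₂, h₂⟩ := hr ε hε0
  obtain ⟨n₃, h₃⟩ := hh (γ / 8) (by positivity)
  set n := max (max n₁ n₂) n₃
  have h₃ := h₃ n (by omega)
  -- Relative to the minimal limit level, `x₀` has value at most `γ / 8 < q`, while `q + 2 * ε` is
  -- below `γ / 4 + γ / 4`. In any pair at distance more than `r`, one point has value at least `7γ
  -- / 8`.
  obtain ⟨q, hq, hq'⟩ := exists_rat_btwn (show throughAct f β n 0 + h x₀ + γ / 8 <
    throughAct f β n 0 + h x₀ + γ / 4 by linarith)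
  refine ⟨n, q, ε, h₁.extend_left (by omega) (by omega), h₂.extend_right (by omega) (by omega),
    ⟨x₀, ?_⟩, fun x y => (hgap x y).imp_right fun hxy => ?_⟩
  · linarith [(abs_le.1 (h₃ x₀)).2]
  · rw [le_max_iff] at hxy ⊢
    refine hxy.imp (fun h => ?_) fun h => ?_
    · linarith [(abs_le.1 (h₃ x)).1]
    · linarith [(abs_le.1 (h₃ y)).1]

end Localization

/-! ### Generic uniqueness of minima -/

/-- Envelope argument: the minimal value is Lipschitz in `c`, hence differentiable almost everywhere
by Rademacher, and its derivative in direction `i` is `-F i x` for every minimizer `x`. Injectivity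
of `F` then leaves only one minimizer. -/
theorem ae_unique_min {X : Type*} [TopologicalSpace X] [CompactSpace X] [Nonempty X] {M : ℕ}
    (h : C(X, ℝ)) (F : Fin M → C(X, ℝ)) (hF : Function.Injective fun x i => F i x) :
    ∀ᵐ c : Fin M → ℝ, ∀ x y, (∀ z, h x - ∑ i, c i * F i x ≤ h z - ∑ i, c i * F i z) →
      (∀ z, h y - ∑ i, c i * F i y ≤ h z - ∑ i, c i * F i z) → x = y := by
  let u : (Fin M → ℝ) → X → ℝ := fun c x => h x - ∑ i, c i * F i x
  have hu : ∀ c, Continuous (u c) := fun c => by fun_prop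
  choose p hp using fun c => isCompact_univ.exists_isMinOn (univ_nonempty (α := X))
    (hu c).continuousOn
  have hp' : ∀ c z, u c (p c) ≤ u c z := fun c z => (hp c).2 (mem_univ z)
  let C : NNReal := ∑ i, ‖F i‖₊
  have hlip : LipschitzWith C fun c => u c (p c) := by
    refine LipschitzWith.of_le_add_mul C fun c c' => ?_
    refine (hp' c (p c')).trans ?_
    have : u c (p c') - u c' (p c') ≤ C * dist c c' := by
      have e : u c (p c') - u c' (p c') = ∑ i, (c' i - c i) * F i (p c') := by
        simp only [u, sub_mul, Finset.sum_sub_distrib]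
        ring
      rw [e]
      simp only [C, NNReal.coe_sum, Finset.sum_mul, coe_nnnorm]
      refine Finset.sum_le_sum fun i _ => (le_abs_self _).trans ?_
      rw [abs_mul, mul_comm]
      refine mul_le_mul ((F i).norm_coe_le_norm _) ?_ (abs_nonneg _) (norm_nonneg _)
      rw [abs_sub_comm, ← Real.dist_eq]
      exact dist_le_pi_dist c c' i
    linarith
  filter_upwards [hlip.ae_differentiableAt (μ := volume)] with c hc x y hx hy
  have key : ∀ x, (∀ z, u c x ≤ u c z) → ∀ i,
      fderiv ℝ (fun c => u c (p c)) c (Pi.single i 1) = -F i x := by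
    intro x hx i
    -- For fixed `x`, the excess over the minimal value is nonnegative in `c'` and vanishes at `c`.
    have hmin : IsLocalMin (fun c' => u c' x - u c' (p c')) c := by
      refine Filter.Eventually.of_forall fun c' => ?_
      have h₁ := hp' c' x
      have h₂ := hx (p c)
      simp only
      linarith
    have hd : HasFDerivAt (fun c' : Fin M → ℝ => u c' x)
        (-∑ i, (ContinuousLinearMap.proj (R := ℝ) (φ := fun _ : Fin M => ℝ) i).smulRight (F i x))
        c := by
      have hs : HasFDerivAt (fun c' : Fin M → ℝ => ∑ i, c' i * F i x)
          (∑ i, (ContinuousLinearMap.proj (R := ℝ) (φ := fun _ : Fin M => ℝ) i).smulRight (F i x))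
          c := by
        refine HasFDerivAt.fun_sum fun i _ => ?_
        exact ((ContinuousLinearMap.proj (R := ℝ) (φ := fun _ : Fin M => ℝ) i).smulRight
          (F i x)).hasFDerivAt
      simpa [u] using hs.const_sub (h x)
    have := hmin.hasFDerivAt_eq_zero (hd.sub hc.hasFDerivAt)
    have := DFunLike.congr_fun this (Pi.single i 1)
    simp [Pi.single_apply, sub_eq_zero] at this
    rw [← this]
  exact hF (funext fun i => by
    have := (key x hx i).symm.trans (key y hy i)
    simpa using this)

/-! ### Kick patterns for which the action function nearly separates -/

section Patterns

variable {X : Type*} [SeminormedAddCommGroup X]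

theorem le_pathCost {f : ℤ → C(X, ℝ)} (β : X) (m n : ℤ) (z : ℤ → X) :
    -∑ j ∈ Finset.Ico m n, f j (z j) ≤ pathCost f β m n z := by
  rw [← Finset.sum_neg_distrib]
  exact Finset.sum_le_sum fun j _ => by
    simp only [stepCost]
    have : 0 ≤ ‖z (j + 1) - z j - β‖ ^ 2 := by positivity
    linarith

/-- Moving by exactly `β` at each step costs no kinetic energy. -/
theorem pathCost_line (f : ℤ → C(X, ℝ)) (β x₀ : X) (m n : ℤ) :
    pathCost f β m n (fun j => x₀ + j • β) =
      -∑ j ∈ Finset.Ico m n, f j (x₀ + j • β) := by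
  rw [← Finset.sum_neg_distrib]
  refine Finset.sum_congr rfl fun j _ => ?_
  simp [stepCost, add_smul]

theorem norm_sub_line_step (β x₀ w : X) (j : ℤ) :
    ‖x₀ + (j + 1) • β - w - β‖ = ‖x₀ + j • β - w‖ := by
  congr 1
  rw [add_smul, one_smul]
  abel

variable [CompactSpace X]

theorem exists_norm_le_of_compact : ∃ D : ℝ, 0 ≤ D ∧ ∀ x : X, ‖x‖ ≤ D := by
  obtain ⟨D, hD⟩ := isCompact_univ.exists_bound_of_continuousOn (continuous_id (X := X)).continuousOn
  exact ⟨D, (norm_nonneg _).trans (hD 0 (mem_univ _)), fun x => hD x (mem_univ x)⟩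

/-- Recurrence of the rotation by `β`: two close terms of a convergent subsequence of multiples of
`β` differ by a return to `0`. -/
theorem infinite_setOf_norm_zsmul_lt (β : X) (k : ℤ) {η : ℝ} (hη : 0 < η) :
    {j : ℤ | k < j ∧ ‖j • β‖ < η}.Infinite := by
  refine infinite_of_forall_exists_gt fun k' => ?_
  -- Using only multiples of `l` makes every positive difference of indices exceed both `k` and
  -- `k'`.
  set l : ℕ := (max k k').toNat + 1
  have hl : max k k' < l := by simp only [l]; omega
  obtain ⟨a, φ, hφ, hlim⟩ := CompactSpace.tendsto_subseq fun n : ℕ => (n * l) • β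
  obtain ⟨N, hN⟩ := Metric.cauchySeq_iff'.1 hlim.cauchySeq η hη
  have hN := hN (N + 1) (by omega)
  have hlt : φ N < φ (N + 1) := hφ (by omega)
  obtain ⟨i, hi⟩ := Nat.exists_eq_add_of_lt hlt
  refine ⟨((i + 1) * l : ℕ), ⟨?_, ?_⟩, ?_⟩
  · push_cast
    nlinarith [le_max_left k k']
  · rw [dist_eq_norm] at hN
    simp only [Function.comp_apply, hi] at hN
    rw [natCast_zsmul]
    convert hN using 2
    rw [add_assoc, add_mul (φ N), add_smul (φ N * l), add_sub_cancel_left]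
  · push_cast
    nlinarith [le_max_right k k']

/-- A pattern built from kicks with nondegenerate maxima along the line `x₀ + jβ`. -/
theorem exists_pattern_near_line {𝒢 : Set C(X, ℝ)} (β : X)
    (h𝒢 : ∀ y, ∃ G ∈ 𝒢, ∃ δ > 0, ∀ x, δ * ‖y - x‖ ^ 2 ≤ G y - G x) (x₀ : X) (C : ℝ) {ε : ℝ}
    (hε : 0 < ε) :
    ∃ (N : ℤ) (g : ℤ → C(X, ℝ)) (c : ℤ → X), 2 < N ∧ (∀ j, g j ∈ 𝒢) ∧
      (∀ j x, g j x ≤ g j (c j)) ∧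
      ∑ j ∈ Finset.Ico 0 N, (g j (c j) - g j (x₀ + j • β)) ≤ ε ∧
      ∀ z : ℤ → X, ∑ j ∈ Finset.Ico 1 N, (g j (c j) - g j (z j)) ≤ C →
        ∃ j, 1 < j ∧ j + 1 < N ∧ 1 / 2 * ‖x₀ + j • β - z j‖ ^ 2 ≤ ε := by
  choose G hG δ hδ hmax using h𝒢
  -- At a return time the line is within `r` of `x₀`; a path also within `r` of `x₀` is within `2 *
  -- r` of the line, with jump cost at most `2 * r ^ 2 ≤ ε`.
  set r := min 1 (ε / 2) with hr
  have hr0 : 0 < r := by positivity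
  have hrε : 2 * r ^ 2 ≤ ε := by nlinarith [min_le_left 1 (ε / 2), min_le_right 1 (ε / 2)]
  -- A path staying at distance `r` from `x₀` at all `n` return times loses at least `n * δ x₀ * r ^
  -- 2 > C`.
  obtain ⟨n, hn⟩ := exists_nat_gt (max 1 (C / (δ x₀ * r ^ 2)))
  have hn1 : (1 : ℝ) < n := (le_max_left _ _).trans_lt hn
  have hnC : C < n * (δ x₀ * r ^ 2) := by
    have := (le_max_right _ _).trans_lt hn
    rwa [div_lt_iff₀ (by have := hδ x₀; positivity)] at this
  obtain ⟨η, hη, hGη⟩ := Metric.continuousAt_iff.1 (G x₀).continuous.continuousAt (ε / n)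
    (by positivity)
  obtain ⟨J, hJ, hJn⟩ := (infinite_setOf_norm_zsmul_lt β 1
    (lt_min hη hr0)).exists_subset_card_eq n
  have hJ0 : J.Nonempty := Finset.card_pos.1 (by rw [hJn]; exact_mod_cast one_pos.trans hn1)
  have hJ1 : ∀ j ∈ J, 1 < j := fun j hj => (hJ hj).1
  have hJN : ∀ j ∈ J, j ≤ J.max' hJ0 := fun j hj => J.le_max' j hj
  obtain ⟨j₀, hj₀⟩ := id hJ0
  have hN := hJ1 j₀ hj₀
  have hN' := hJN j₀ hj₀
  set N := J.max' hJ0 + 2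
  -- The constant `δ` is not uniform in the maximum point, so the same kick `G x₀` is repeated at
  -- all return times. At the other times the maximum lies on the line itself, and the line loses
  -- nothing.
  let c : ℤ → X := fun j => if j ∈ J then x₀ else x₀ + j • β
  have hmax' : ∀ y x, G y x ≤ G y y := fun y x => by
    have h1 := hmax y x
    have h2 := hδ y
    have : 0 ≤ δ y * ‖y - x‖ ^ 2 := by positivity
    linarith
  refine ⟨N, fun j => G (c j), c, by omega, fun j => hG _, fun j x => hmax' _ _, ?_, ?_⟩
  · have hsub : J ⊆ Finset.Ico 0 N := fun j hj => by
      have := hJ1 j hj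
      have := hJN j hj
      rw [Finset.mem_Ico]
      omega
    rw [← Finset.sum_subset hsub]
    · refine (Finset.sum_le_card_nsmul J _ (ε / n) fun j hj => ?_).trans ?_
      · have hd : dist (x₀ + j • β) x₀ < η := by
          rw [dist_eq_norm, add_sub_cancel_left]
          exact (hJ hj).2.trans_le (min_le_left _ _)
        have := hGη hd
        rw [Real.dist_eq] at this
        simp only [c, if_pos hj]
        linarith [(abs_lt.1 this).1]
      · rw [hJn, nsmul_eq_mul]
        field_simp
        exact le_rfl
    · intro j _ hj
      simp [c, hj]
  · intro z hz
    by_contra! hfar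
    have hlow : ∀ j ∈ J, δ x₀ * r ^ 2 ≤ G (c j) (c j) - G (c j) (z j) := fun j hj => by
      have h1 := hfar j (hJ1 j hj) (by have := hJN j hj; omega)
      have h2 : ‖j • β‖ < r := (hJ hj).2.trans_le (min_le_right _ _)
      have h3 : ‖x₀ + j • β - z j‖ ≤ ‖x₀ - z j‖ + ‖j • β‖ := by
        rw [add_sub_right_comm]
        exact norm_add_le _ _
      have h4 : r ≤ ‖x₀ - z j‖ := by
        by_contra! h
        have h5 : ‖x₀ + j • β - z j‖ ≤ 2 * r := by linarith
        nlinarith [norm_nonneg (x₀ + j • β - z j)]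
      have h6 := hmax x₀ (z j)
      have h7 : δ x₀ * r ^ 2 ≤ δ x₀ * ‖x₀ - z j‖ ^ 2 := by
        have := hδ x₀
        gcongr
      simp only [c, if_pos hj]
      linarith
    have h1 := Finset.card_nsmul_le_sum J _ _ hlow
    rw [hJn, nsmul_eq_mul] at h1
    have hsub : J ⊆ Finset.Ico 1 N := fun j hj => by
      have := hJ1 j hj
      have := hJN j hj
      rw [Finset.mem_Ico]
      omega
    have h2 := Finset.sum_le_sum_of_subset_of_nonneg hsub
      (f := fun j => G (c j) (c j) - G (c j) (z j)) fun j _ _ => by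
        linarith [hmax' (c j) (z j)]
    linarith

/-- Either the path comes near the line, and switching there between path and line is cheap, or it
loses at least as much from the kicks as the largest possible one-step kinetic cost `D ^ 2 / 2`. In
the latter case the competitor jumps onto the line in the first step, or off it in the last one. -/
theorem exists_pattern_attracting {𝒢 : Set C(X, ℝ)} (β : X)
    (h𝒢 : ∀ y, ∃ G ∈ 𝒢, ∃ δ > 0, ∀ x, δ * ‖y - x‖ ^ 2 ≤ G y - G x) (x₀ : X) {ε : ℝ}
    (hε : 0 < ε) :
    ∃ (N : ℤ) (g : ℤ → C(X, ℝ)), 0 < N ∧ (∀ j, g j ∈ 𝒢) ∧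
      (∀ x w, dAct g β 0 N x (x₀ + N • β) ≤ dAct g β 0 N x w + ε) ∧
      ∀ w y, dAct g β 0 N x₀ y ≤ dAct g β 0 N w y + ε := by
  obtain ⟨D, hD0, hD⟩ := exists_norm_le_of_compact (X := X)
  -- One half of `ε` pays for the kicks missed by the line, the other for the jump. The losses are
  -- counted from time `1` because a jump in the first step shares the kick at time `0` with the
  -- given path.
  obtain ⟨N, g, c, hN, hg, hmax, hsum, hnear⟩ :=
    exists_pattern_near_line β h𝒢 x₀ (1 / 2 * D ^ 2) (half_pos hε)
  have hD2 : ∀ x : X, 1 / 2 * ‖x‖ ^ 2 ≤ 1 / 2 * D ^ 2 := fun x => by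
    have := hD x
    gcongr
  have hsplit : ∀ {m n : ℤ} (z : ℤ → X), ∑ j ∈ Finset.Ico m n, (g j (c j) - g j (z j)) =
      ∑ j ∈ Finset.Ico m n, g j (c j) - ∑ j ∈ Finset.Ico m n, g j (z j) := fun z =>
    Finset.sum_sub_distrib ..
  have hnn : ∀ {m n : ℤ} (z : ℤ → X), 0 ≤ ∑ j ∈ Finset.Ico m n, (g j (c j) - g j (z j)) :=
    fun z => Finset.sum_nonneg fun j _ => by linarith [hmax j (z j)]
  have hlow : ∀ {m n : ℤ} (z : ℤ → X), ∑ j ∈ Finset.Ico m n, (g j (c j) - g j (z j)) -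
      ∑ j ∈ Finset.Ico m n, g j (c j) ≤ pathCost g β m n z := fun {m n} z => by
    rw [hsplit]
    linarith [le_pathCost (f := g) β m n z]
  have hline : ∀ {m n : ℤ}, 0 ≤ m → m ≤ n → n ≤ N →
      pathCost g β m n (fun j => x₀ + j • β) ≤ ε / 2 - ∑ j ∈ Finset.Ico m n, g j (c j) := by
    intro m n hm hmn hn
    rw [pathCost_line]
    have h1 := sum_Ico_consecutive_int (fun j => g j (c j) - g j (x₀ + j • β)) hm (hmn.trans hn)
    have h2 := sum_Ico_consecutive_int (fun j => g j (c j) - g j (x₀ + j • β)) hmn hn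
    have h3 := hsplit (m := m) (n := n) fun j => x₀ + j • β
    linarith [hnn (m := 0) (n := m) fun j => x₀ + j • β,
      hnn (m := n) (n := N) fun j => x₀ + j • β]
  have hsucc : ∀ {m n : ℤ}, m ≤ n → ∑ j ∈ Finset.Ico m (n + 1), g j (c j) =
      ∑ j ∈ Finset.Ico m n, g j (c j) + g n (c n) := fun {m n} h => by
    have : Finset.Ico n (n + 1) = {n} := by ext; simp; omega
    rw [sum_Ico_consecutive_int _ h (by omega : n ≤ n + 1), this, Finset.sum_singleton]
  refine ⟨N, g, by omega, hg, fun x w => ?_, fun w y => ?_⟩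
  · obtain ⟨z, rfl, rfl, hz⟩ := exists_pathCost_eq g β (by omega : (0 : ℤ) < N) x w
    rw [← hz]
    rcases le_or_gt (∑ j ∈ Finset.Ico 1 N, (g j (c j) - g j (z j))) (1 / 2 * D ^ 2) with hC | hC
    · obtain ⟨j, hj1, hjN, hj⟩ := hnear z hC
      have e1 := dAct_triangle g β (by omega : (0 : ℤ) < j) (by omega : j < N) (z 0) (z j)
        (x₀ + N • β)
      have e2 := dAct_triangle g β (by omega : j < j + 1) hjN (z j) (x₀ + (j + 1) • β) (x₀ + N • β)
      have e3 := dAct_le_pathCost g β 0 j z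
      have e4 := dAct_le_pathCost g β (j + 1) N (fun j => x₀ + j • β)
      have e5 := hline (by omega : (0 : ℤ) ≤ j + 1) hjN.le le_rfl
      have e6 := hlow (m := j + 1) (n := N) z
      have e7 := hnn (m := j + 1) (n := N) z
      rw [dAct_succ, stepCost, norm_sub_line_step] at e2
      rw [pathCost_add g β (by omega : (0 : ℤ) ≤ j) (by omega : j ≤ N),
        pathCost_add g β (by omega : j ≤ j + 1) hjN.le, pathCost_succ, stepCost]
      have e8 : 0 ≤ 1 / 2 * ‖z (j + 1) - z j - β‖ ^ 2 := by positivity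
      linarith
    · have e1 := dAct_triangle g β (by omega : (0 : ℤ) < 0 + 1) (by omega : 0 + 1 < N) (z 0)
        (x₀ + (0 + 1 : ℤ) • β) (x₀ + N • β)
      have e2 := dAct_le_pathCost g β (0 + 1) N (fun j => x₀ + j • β)
      have e3 := hline (by omega : (0 : ℤ) ≤ 0 + 1) (by omega) le_rfl
      have e4 := hlow (m := 0 + 1) (n := N) z
      rw [dAct_succ, stepCost] at e1
      rw [pathCost_add g β (by omega : (0 : ℤ) ≤ 0 + 1) (by omega : 0 + 1 ≤ N), pathCost_succ,
        stepCost]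
      have e5 := hD2 (x₀ + (0 + 1 : ℤ) • β - z 0 - β)
      have e6 : 0 ≤ 1 / 2 * ‖z (0 + 1) - z 0 - β‖ ^ 2 := by positivity
      rw [zero_add] at *
      linarith
  · obtain ⟨z, rfl, rfl, hz⟩ := exists_pathCost_eq g β (by omega : (0 : ℤ) < N) w y
    rw [← hz]
    rcases le_or_gt (∑ j ∈ Finset.Ico 1 N, (g j (c j) - g j (z j))) (1 / 2 * D ^ 2) with hC | hC
    · obtain ⟨j, hj1, hjN, hj⟩ := hnear z hC
      obtain ⟨i, rfl⟩ : ∃ i, j = i + 1 := ⟨j - 1, by omega⟩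
      have e1 := dAct_triangle g β (by omega : (0 : ℤ) < i + 1) (by omega : i + 1 < N) x₀
        (z (i + 1)) (z N)
      have e2 := dAct_triangle g β (by omega : (0 : ℤ) < i) (by omega : i < i + 1) x₀
        (x₀ + i • β) (z (i + 1))
      have e3 := dAct_le_pathCost g β (i + 1) N z
      have e4 := dAct_le_pathCost g β 0 i (fun j => x₀ + j • β)
      have e5 := hline le_rfl (by omega : 0 ≤ i + 1) (by omega)
      have e6 := hlow (m := 0) (n := i + 1) z
      have e7 := hnn (m := 0) (n := i + 1) z
      have e8 : ‖z (i + 1) - (x₀ + i • β) - β‖ = ‖x₀ + (i + 1) • β - z (i + 1)‖ := by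
        rw [norm_sub_rev (x₀ + _)]
        congr 1
        rw [add_smul, one_smul]
        abel
      rw [dAct_succ, stepCost, e8] at e2
      rw [pathCost_add g β (by omega : (0 : ℤ) ≤ i) (by omega : i ≤ i + 1), pathCost_line,
        pathCost_succ, stepCost] at e5
      simp only [zero_smul, add_zero] at e4
      rw [pathCost_line] at e4
      rw [pathCost_add g β (by omega : (0 : ℤ) ≤ i + 1) (by omega : i + 1 ≤ N)]
      have e9 : 0 ≤ 1 / 2 * ‖x₀ + (i + 1) • β - (x₀ + i • β) - β‖ ^ 2 := by positivity
      linarith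
    · obtain ⟨n, rfl⟩ : ∃ n, N = n + 1 := ⟨N - 1, by omega⟩
      have e1 := dAct_triangle g β (by omega : (0 : ℤ) < n) (by omega : n < n + 1) x₀
        (x₀ + n • β) (z (n + 1))
      have e2 := dAct_le_pathCost g β 0 n (fun j => x₀ + j • β)
      have e3 := hline le_rfl (by omega : 0 ≤ n + 1) le_rfl
      have e4 := hlow (m := 0) (n := n + 1) z
      have e5 := sum_Ico_consecutive_int (fun j => g j (c j) - g j (z j)) zero_le_one
        (by omega : 1 ≤ n + 1)
      have e6 := hnn (m := 0) (n := 1) z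
      rw [dAct_succ, stepCost] at e1
      have e7 := hD2 (z (n + 1) - (x₀ + n • β) - β)
      rw [pathCost_add g β (by omega : (0 : ℤ) ≤ n) (by omega : n ≤ n + 1), pathCost_line,
        pathCost_succ, stepCost] at e3
      simp only [zero_smul, add_zero] at e2
      rw [pathCost_line] at e2
      have e9 : 0 ≤ 1 / 2 * ‖x₀ + (n + 1) • β - (x₀ + n • β) - β‖ ^ 2 := by positivity
      linarith

/-- The first pattern makes `x₁` a nearly optimal endpoint for every start, the second makes it a
nearly optimal start for every endpoint. Through `x₁` the action nearly splits into a function of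
`x` plus a function of `y`. -/
theorem exists_sep_pattern_of_maxima {𝒢 : Set C(X, ℝ)} (β : X)
    (h𝒢 : ∀ y, ∃ G ∈ 𝒢, ∃ δ > 0, ∀ x, δ * ‖y - x‖ ^ 2 ≤ G y - G x) {ε : ℝ} (hε : 0 < ε) :
    ∃ (N : ℕ) (g : ℤ → C(X, ℝ)), 0 < N ∧ (∀ j, g j ∈ 𝒢) ∧ Sep (dAct g β 0 N) ε := by
  -- Four halves of paths are redirected through `x₁`, each at a cost of `ε / 4`.
  obtain ⟨N₁, g₁, hN₁, hg₁, h₁, -⟩ := exists_pattern_attracting β h𝒢 0 (ε := ε / 4) (by positivity)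
  set x₁ : X := 0 + N₁ • β
  obtain ⟨N₂, g₂, hN₂, hg₂, -, h₂⟩ := exists_pattern_attracting β h𝒢 x₁ (ε := ε / 4) (by positivity)
  lift N₁ to ℕ using hN₁.le
  lift N₂ to ℕ using hN₂.le
  let g : ℤ → C(X, ℝ) := fun j => if j < N₁ then g₁ j else g₂ (j - N₁)
  refine ⟨N₂ + N₁, g, by omega, fun j => ?_, ?_⟩
  · simp only [g]
    split_ifs
    exacts [hg₁ _, hg₂ _]
  have e₁ : dAct g β 0 N₁ = dAct g₁ β 0 N₁ := dAct_congr fun j _ hj => by simp [g, hj]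
  have e₂ : dAct g β N₁ (N₂ + N₁ : ℕ) = dAct g₂ β 0 N₂ := by
    have hc : dAct (fun j => g (j + N₁)) β 0 N₂ = dAct g₂ β 0 N₂ := dAct_congr fun j hj _ => by
      simp [g, hj]
    ext x y
    rw [← hc, ← dAct_shift]
    simp
  intro x x' y y'
  have hlt : (N₁ : ℤ) < (N₂ + N₁ : ℕ) := by omega
  obtain ⟨w, hw⟩ := exists_dAct_split g β hN₁ hlt x y'
  obtain ⟨w', hw'⟩ := exists_dAct_split g β hN₁ hlt x' y
  have t := dAct_triangle g β hN₁ hlt x x₁ y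
  have t' := dAct_triangle g β hN₁ hlt x' x₁ y'
  rw [e₁, e₂] at hw hw' t t'
  linarith [h₁ x w, h₁ x' w', h₂ w' y, h₂ w y']

/-- Without kicks, dividing the displacement relative to the drift into `N` equal steps connects any
two points at cost at most `D ^ 2 / (2 * N)`, so the whole kernel is nearly constant. -/
theorem exists_sep_pattern_of_zero {𝒢 : Set C(X, ℝ)} (β : X) (h𝒢 : 0 ∈ 𝒢) {D : ℝ}
    (hdiv : ∀ (N : ℕ), 0 < N → ∀ z : X, ∃ u : X, N • u = z ∧ ‖u‖ ≤ D / N) {ε : ℝ} (hε : 0 < ε) :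
    ∃ (N : ℕ) (g : ℤ → C(X, ℝ)), 0 < N ∧ (∀ j, g j ∈ 𝒢) ∧ Sep (dAct g β 0 N) ε := by
  obtain ⟨N, hN⟩ := exists_nat_gt (max 1 (D ^ 2 / ε))
  have hN1 : (1 : ℝ) < N := (le_max_left _ _).trans_lt hN
  have hN0 : 0 < N := by exact_mod_cast one_pos.trans hN1
  have hNε : D ^ 2 < N * ε := (div_lt_iff₀ hε).1 ((le_max_right _ _).trans_lt hN)
  refine ⟨N, fun _ => 0, hN0, fun _ => h𝒢, ?_⟩
  have hlow : ∀ x y : X, 0 ≤ dAct (fun _ => 0) β 0 N x y := fun x y => by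
    obtain ⟨z, -, -, hz⟩ := exists_pathCost_eq (fun _ => 0) β (by omega : (0 : ℤ) < N) x y
    rw [← hz]
    simpa using le_pathCost (f := fun _ => 0) β 0 N z
  have hup : ∀ x y : X, dAct (fun _ => 0) β 0 N x y ≤ ε / 2 := fun x y => by
    obtain ⟨u, hu, hun⟩ := hdiv N hN0 (y - x - N • β)
    let z : ℤ → X := fun j => x + j • (β + u)
    have h := dAct_le_pathCost (fun _ => 0) β 0 N z
    have hz0 : z 0 = x := by simp [z]
    have hzN : z N = y := by simp [z, smul_add, hu]
    rw [hz0, hzN] at h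
    refine h.trans ?_
    have hstep : ∀ j ∈ Finset.Ico (0 : ℤ) N, stepCost (fun _ => (0 : C(X, ℝ))) β j (z j) (z (j + 1))
        ≤ 1 / 2 * (D / N) ^ 2 := fun j _ => by
      have : z (j + 1) - z j - β = u := by
        simp only [z, add_smul, one_smul]
        abel
      simp only [stepCost, this, ContinuousMap.coe_zero, Pi.zero_apply, sub_zero]
      gcongr
    refine (Finset.sum_le_card_nsmul _ _ _ hstep).trans ?_
    rw [Int.card_Ico, nsmul_eq_mul]
    simp only [sub_zero, Int.toNat_natCast]
    field_simp
    linarith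
  intro x x' y y'
  linarith [hup x y, hup x' y', hlow x y', hlow x' y]

end Patterns

/-! ### Random kicks -/

section RandomKicks

theorem measurable_update_of_measurable {Ω ι S : Type*} [DecidableEq ι] {m : MeasurableSpace Ω}
    [MeasurableSpace S] {ξ : ι → Ω → S} (i : ι) (a : S) (h : ∀ j ≠ i, Measurable (ξ j)) :
    Measurable fun ω => Function.update (fun j => ξ j ω) i a := by
  refine measurable_pi_iff.2 fun j => ?_
  by_cases hj : j = i
  · subst hj
    simp only [Function.update_self]
    exact measurable_const
  · simpa only [Function.update_of_ne hj] using h j hj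

theorem indepFun_update_zero {Ω : Type*} [MeasurableSpace Ω] {μ : Measure Ω} {M : ℕ}
    {ξ : ℤ → Ω → Fin M → ℝ} (hm : ∀ j, Measurable (ξ j)) (hi : iIndepFun ξ μ) :
    IndepFun (fun ω => Function.update (fun j => ξ j ω) 0 (0 : Fin M → ℝ)) (ξ 0) μ := by
  have hle : ∀ j, MeasurableSpace.comap (ξ j) inferInstance ≤ (inferInstance : MeasurableSpace Ω) :=
    fun j => (hm j).comap_le
  have hd := indep_iSup_of_disjoint hle hi (S := {j | j ≠ 0}) (T := {0}) (by simp)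
  refine indep_of_indep_of_le_left (indep_of_indep_of_le_right hd ?_) ?_
  · exact le_iSup₂_of_le (0 : ℤ) (mem_singleton _) le_rfl
  · refine Measurable.comap_le (measurable_update_of_measurable (0 : ℤ) 0 fun j hj => ?_)
    rw [measurable_iff_comap_le]
    exact le_iSup₂_of_le (f := fun i (_ : i ∈ {j : ℤ | j ≠ 0}) =>
      MeasurableSpace.comap (ξ i) inferInstance) j hj le_rfl

theorem measurableSet_localized_comp {X : Type*} [SeminormedAddCommGroup X] [CompactSpace X]
    {S S' : Type*} [TopologicalSpace S] [SecondCountableTopology S] [MeasurableSpace S]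
    [BorelSpace S] [MeasurableSpace S'] {f : S → ℤ → C(X, ℝ)} (hf : Continuous f) {u : S' → S}
    (hu : Measurable u) {ρ : S' → ℝ} (hρ : Measurable ρ) (β : X) (n : ℕ) :
    MeasurableSet {s | Localized (f (u s)) β n (ρ s)} :=
  (hu.prodMk hρ) (measurableSet_localized hf β n)

variable {Ω : Type*} [MeasurableSpace Ω] {μ : Measure Ω} [IsProbabilityMeasure μ]

/-- Disjoint blocks of length `N` match the pattern independently with the same positive
probability; the second Borel–Cantelli lemma applies. -/
theorem ae_exists_block {S : Type*} [MeasurableSpace S] {ν : Measure S} {ζ : ℕ → Ω → S}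
    (hm : ∀ j, Measurable (ζ j)) (hi : iIndepFun ζ μ) (hν : ∀ j, μ.map (ζ j) = ν) {N : ℕ}
    {C : ℕ → Set S} (hC : ∀ j, MeasurableSet (C j)) (hpos : ∀ j, 0 < ν (C j)) :
    ∀ᵐ ω ∂μ, ∃ p : ℕ, ∀ j < N, ζ (p * N + j) ω ∈ C j := by
  let B : ℕ → Set Ω := fun p => ⋂ j ∈ Finset.range N, ζ (p * N + j) ⁻¹' C j
  have hB : ∀ p, MeasurableSet (B p) := fun p =>
    Finset.measurableSet_biInter _ fun j _ => hm _ (hC j)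
  have key : ∀ s : Finset ℕ, μ (⋂ p ∈ s, B p) = ∏ _p ∈ s, ∏ j ∈ Finset.range N, ν (C j) := by
    intro s
    have hinj : Set.InjOn (fun q : ℕ × ℕ => q.1 * N + q.2)
        (s ×ˢ Finset.range N : Finset (ℕ × ℕ)) := by
      rintro ⟨p, j⟩ hp ⟨p', j'⟩ hp' h
      simp only [Finset.coe_product, Finset.coe_range, mem_prod, Finset.mem_coe, mem_Iio] at hp hp'
      simp only at h
      have h1 : j = j' := by
        have := congrArg (· % N) h
        simpa [Nat.mod_eq_of_lt hp.2, Nat.mod_eq_of_lt hp'.2] using this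
      have h2 : p * N = p' * N := by omega
      have h3 : 0 < N := by omega
      rw [Prod.mk.injEq]
      exact ⟨Nat.eq_of_mul_eq_mul_right h3 h2, h1⟩
    have h := hi.measure_inter_preimage_eq_mul
      ((s ×ˢ Finset.range N).image fun q : ℕ × ℕ => q.1 * N + q.2)
      (sets := fun i => C (i % N)) fun i _ => hC _
    rw [Finset.prod_image hinj, Finset.prod_product] at h
    have e : (⋂ i ∈ (s ×ˢ Finset.range N).image fun q : ℕ × ℕ => q.1 * N + q.2,
        ζ i ⁻¹' C (i % N)) = ⋂ p ∈ s, B p := by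
      ext ω
      simp only [Finset.mem_image, Finset.mem_product, Finset.mem_range, mem_iInter, B,
        mem_preimage, Prod.exists]
      constructor
      · intro h p hp j hj
        simpa [Nat.mod_eq_of_lt hj] using h (p * N + j) ⟨p, j, ⟨hp, hj⟩, rfl⟩
      · rintro h i ⟨p, j, ⟨hp, hj⟩, rfl⟩
        simpa [Nat.mod_eq_of_lt hj] using h p hp j hj
    rw [e] at h
    rw [h]
    refine Finset.prod_congr rfl fun p _ => Finset.prod_congr rfl fun j hj => ?_
    rw [Finset.mem_range] at hj
    have : (p * N + j) % N = j := by simp [Nat.mod_eq_of_lt hj]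
    simp only [this]
    rw [← Measure.map_apply (hm _) (hC j), hν]
  have h1 : ∀ p, μ (B p) = ∏ j ∈ Finset.range N, ν (C j) := fun p => by
    simpa using key {p}
  have hind : iIndepSet B μ := (iIndepSet_iff_meas_biInter hB).2 fun s => by
    rw [key]
    simp only [h1]
  have hsum : ∑' p, μ (B p) = ∞ := by
    simp only [h1]
    refine ENNReal.tsum_const_eq_top_of_ne_zero ?_
    exact Finset.prod_ne_zero_iff.2 fun j _ => (hpos j).ne'
  have hlim := measure_limsup_eq_one hB hind hsum
  have hae : ∀ᵐ ω ∂μ, ω ∈ Filter.limsup B Filter.atTop := by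
    rw [← prob_compl_eq_zero_iff (MeasurableSet.measurableSet_limsup hB)] at hlim
    exact hlim
  filter_upwards [hae] with ω hω
  rw [Filter.limsup_eq_iInf_iSup_of_nat] at hω
  simp only [iInf_eq_iInter, iSup_eq_iUnion, mem_iInter, mem_iUnion] at hω
  obtain ⟨p, -, hp⟩ := hω 0
  refine ⟨p, fun j hj => ?_⟩
  simp only [B, mem_iInter, Finset.mem_range] at hp
  exact hp j hj

variable {X : Type*} [SeminormedAddCommGroup X] {M : ℕ}

/-- The kick potentials with coefficients `c` with respect to `F`. -/
def kickC (F : Fin M → C(X, ℝ)) (c : ℤ → Fin M → ℝ) (j : ℤ) : C(X, ℝ) :=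
  ∑ i, c j i • F i

theorem continuous_kickC (F : Fin M → C(X, ℝ)) : Continuous (kickC F) := by
  unfold kickC
  fun_prop

theorem kickC_update (F : Fin M → C(X, ℝ)) (y : ℤ → Fin M → ℝ) (c : Fin M → ℝ) :
    kickC F (Function.update y 0 c) = Function.update (kickC F y) 0 (∑ i, c i • F i) := by
  ext j x
  by_cases h : j = 0
  · subst h
    simp [kickC]
  · simp [kickC, Function.update_of_ne h]

/-- The functions all of whose uniform neighbourhoods are charged by the law of `c · F`. -/
def uniformSupport (ν : Measure (Fin M → ℝ)) (F : Fin M → C(X, ℝ)) : Set C(X, ℝ) :=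
  {G | ∀ ε > 0, 0 < ν {c | ∀ x, |∑ i, c i * F i x - G x| ≤ ε}}

theorem measurableSet_setOf_close (F : Fin M → C(X, ℝ)) (G : C(X, ℝ)) (ε : ℝ) :
    MeasurableSet {c : Fin M → ℝ | ∀ x, |∑ i, c i * F i x - G x| ≤ ε} := by
  rw [ofPred_forall]
  refine (isClosed_iInter fun x => isClosed_le ?_ continuous_const).measurableSet
  fun_prop

variable [CompactSpace X] {ν : Measure (Fin M → ℝ)} {ξ : ℤ → Ω → Fin M → ℝ} {F : Fin M → C(X, ℝ)}

/-- A pattern imitated closely enough somewhere in the past and somewhere in the future keeps its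
separation, which extends to any window containing it. Countably many precisions suffice. -/
theorem ae_exists_sep (hm : ∀ j, Measurable (ξ j)) (hi : iIndepFun ξ μ)
    (hν : ∀ j, μ.map (ξ j) = ν) (β : X)
    (hpat : ∀ ε > 0, ∃ (N : ℕ) (g : ℤ → C(X, ℝ)), 0 < N ∧ (∀ j, g j ∈ uniformSupport ν F) ∧
      Sep (dAct g β 0 N) ε) :
    ∀ᵐ ω ∂μ, ∀ ε > 0, (∃ n : ℕ, Sep (dAct (kickC F fun j => ξ j ω) β (-(n + 1)) 0) ε) ∧
      ∃ n : ℕ, Sep (dAct (kickC F fun j => ξ j ω) β 0 (n + 1)) ε := by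
  suffices h : ∀ l : ℕ, ∀ᵐ ω ∂μ,
      (∃ n : ℕ, Sep (dAct (kickC F fun j => ξ j ω) β (-(n + 1)) 0) (1 / ((l : ℝ) + 1))) ∧
      ∃ n : ℕ, Sep (dAct (kickC F fun j => ξ j ω) β 0 (n + 1)) (1 / ((l : ℝ) + 1)) by
    filter_upwards [ae_all_iff.2 h] with ω hω ε hε
    obtain ⟨l, hl⟩ := exists_nat_one_div_lt hε
    obtain ⟨⟨n₁, h₁⟩, n₂, h₂⟩ := hω l
    exact ⟨⟨n₁, h₁.mono hl.le⟩, n₂, h₂.mono hl.le⟩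
  intro l
  set ε : ℝ := 1 / ((l : ℝ) + 1)
  have hε : 0 < ε := by positivity
  obtain ⟨N, g, hN, hg, hS⟩ := hpat (ε / 2) (by positivity)
  -- By `Sep.of_close` the imitation error is `4 * (N * δ) = ε / 2`.
  set δ : ℝ := ε / 8 / N
  have hNr : (0 : ℝ) < N := by exact_mod_cast hN
  have hδ : 0 < δ := by positivity
  let C : ℤ → Set (Fin M → ℝ) := fun j => {c | ∀ x, |∑ i, c i * F i x - g j x| ≤ δ}
  have hCm : ∀ j, MeasurableSet (C j) := fun j => measurableSet_setOf_close F (g j) δ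
  have hCpos : ∀ j, 0 < ν (C j) := fun j => hg j δ hδ
  have hblock : ∀ (ω : Ω) (p : ℤ), (∀ j : ℤ, 0 ≤ j → j < N → ξ (p + j) ω ∈ C j) →
      Sep (dAct (kickC F fun j => ξ j ω) β p (p + N)) ε := by
    intro ω p hp
    have hsh : dAct (kickC F fun j => ξ j ω) β p (p + N) =
        dAct (fun j => kickC F (fun j => ξ j ω) (j + p)) β 0 N := by
      ext x y
      rw [← dAct_shift, zero_add, add_comm p]
    rw [hsh]
    have := Sep.of_close (f := fun j => kickC F (fun j => ξ j ω) (j + p)) (f' := g) (ε := δ)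
      (by omega) (fun j hj hj' x => by
        have := hp j hj hj' x
        simpa [kickC, add_comm p] using this) hS
    refine this.mono ?_
    simp only [δ, Int.cast_natCast, Int.cast_zero, sub_zero]
    field_simp
    linarith
  have hright := ae_exists_block (μ := μ) (ν := ν) (ζ := fun j : ℕ => ξ j) (N := N)
    (C := fun j => C j) (fun j => hm j) (hi.precomp Nat.cast_injective) (fun j => hν j)
    (fun j => hCm j) fun j => hCpos j
  -- The past is enumerated backwards in time, so the pattern has to be read in reverse.
  have hleft := ae_exists_block (μ := μ) (ν := ν) (ζ := fun j : ℕ => ξ (-(j + 1))) (N := N)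
    (C := fun j => C (N - 1 - j)) (fun j => hm _)
    (hi.precomp (g := fun j : ℕ => -((j : ℤ) + 1)) fun a b h => by simpa using h)
    (fun j => hν _) (fun j => hCm _) fun j => hCpos _
  filter_upwards [hleft, hright] with ω ⟨p, hp⟩ ⟨q, hq⟩
  constructor
  · have hs := hblock ω (-(p * N + N : ℕ)) fun j hj hj' => by
      have := hp (N - 1 - j).toNat (by omega)
      have e1 : (((N : ℤ) - 1 - j).toNat : ℤ) = N - 1 - j := by omega
      push_cast [e1] at this
      have e2 : -((p : ℤ) * N + (N - 1 - j) + 1) = -(p * N + N : ℕ) + j := by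
        push_cast
        ring
      rwa [e2, sub_sub_cancel] at this
    refine ⟨p * N + N, hs.extend (by omega) (by omega) ?_⟩
    push_cast
    have : (0 : ℤ) ≤ p * N := by positivity
    linarith
  · have hs := hblock ω (q * N : ℕ) fun j hj hj' => by
      have := hq j.toNat (by omega)
      have e1 : ((j.toNat : ℕ) : ℤ) = j := by omega
      push_cast [e1] at this
      exact_mod_cast this
    exact ⟨q * N + N, hs.extend (by omega) (by omega) (by push_cast; omega)⟩

/-- Fubini: all kicks except the one at time `0` are frozen, and for almost every value `c` of the
remaining one the limiting profile has a unique minimum. Absolute continuity transfers this from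
Lebesgue measure to the law of `ξ 0`. -/
theorem ae_exists_localized (hm : ∀ j, Measurable (ξ j)) (hi : iIndepFun ξ μ)
    (hν : ∀ j, μ.map (ξ j) = ν) (hac : ν ≪ volume)
    (hF : Function.Injective fun x i => F i x) (β : X)
    (hsep : ∀ᵐ ω ∂μ, ∀ ε > 0,
      (∃ n : ℕ, Sep (dAct (kickC F fun j => ξ j ω) β (-(n + 1)) 0) ε) ∧
      ∃ n : ℕ, Sep (dAct (kickC F fun j => ξ j ω) β 0 (n + 1)) ε) {r : ℝ} (hr : 0 < r) :
    ∀ᵐ ω ∂μ, ∃ n, Localized (kickC F fun j => ξ j ω) β n r := by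
  have : IsProbabilityMeasure ν := hν 0 ▸ Measure.isProbabilityMeasure_map (hm 0).aemeasurable
  let η : Ω → ℤ → Fin M → ℝ := fun ω => Function.update (fun j => ξ j ω) 0 0
  have hη : Measurable η := measurable_update_of_measurable 0 0 fun j _ => hm j
  have : IsProbabilityMeasure (μ.map η) := Measure.isProbabilityMeasure_map hη.aemeasurable
  let B : Set ((ℤ → Fin M → ℝ) × (Fin M → ℝ)) :=
    {p | ¬∃ n, Localized (kickC F (Function.update p.1 0 p.2)) β n r}
  have hcont : Continuous fun p : (ℤ → Fin M → ℝ) × (Fin M → ℝ) =>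
      kickC F (Function.update p.1 0 p.2) :=
    (continuous_kickC F).comp (continuous_fst.update 0 continuous_snd)
  have hB : MeasurableSet B := by
    have hBU : B = (⋃ n, {p | Localized (kickC F (Function.update p.1 0 p.2)) β n r})ᶜ := by
      ext p
      simp [B]
    rw [hBU]
    refine (MeasurableSet.iUnion fun n => ?_).compl
    exact measurableSet_localized_comp hcont measurable_id measurable_const β n
  have hmap : μ.map (fun ω => (η ω, ξ 0 ω)) = (μ.map η).prod ν := by
    rw [← hν 0]
    exact (indepFun_iff_map_prod_eq_prod_map_map hη.aemeasurable (hm 0).aemeasurable).1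
      (indepFun_update_zero hm hi)
  have hB0 : μ.map (fun ω => (η ω, ξ 0 ω)) B = 0 := by
    rw [hmap, Measure.measure_prod_null hB]
    refine (ae_map_iff hη.aemeasurable
      (measurableSet_eq_fun (measurable_measure_prodMk_left hB) measurable_const)).2 ?_
    filter_upwards [hsep] with ω hω
    set f := kickC F fun j => ξ j ω
    have hl : ∀ ε > 0, ∃ n : ℕ, Sep (dAct f β (-(n + 1)) 0) ε := fun ε hε => (hω ε hε).1
    have hr' : ∀ ε > 0, ∃ n : ℕ, Sep (dAct f β 0 (n + 1)) ε := fun ε hε => (hω ε hε).2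
    -- Up to a constant, `h + f 0` is the limiting profile with the kick at time `0` removed.
    -- Putting in the kick with coefficients `c` subtracts `∑ i, c i * F i x`.
    obtain ⟨h, hh⟩ := exists_limit_throughAct hl hr'
    refine hac ?_
    refine measure_mono_null ?_ (ae_iff.1 (ae_unique_min (h + f 0) F hF))
    intro c hc huniq
    refine hc ?_
    have hup : kickC F (Function.update (η ω) 0 c) = Function.update f 0 (∑ i, c i • F i) := by
      rw [← kickC_update]
      simp [η]
    simp only
    rw [hup]
    set φ : C(X, ℝ) := ∑ i, c i • F i with hφ
    have hφx : ∀ x, φ x = ∑ i, c i * F i x := fun x => by simp [hφ]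
    refine exists_localized_of_unique_min
      (h := h + f 0 - φ - ContinuousMap.const X (f 0 0 - φ 0)) ?_ ?_ ?_ ?_ hr
    · simpa only [update_dAct_left] using hl
    · intro ε hε
      obtain ⟨n, hn⟩ := hr' ε hε
      -- Replacing the kick at time `0` adds a function of the first variable, which cancels in
      -- `Sep`.
      refine ⟨n, fun x x' y y' => ?_⟩
      simp only [update_dAct_right f β (by omega : (0 : ℤ) < n + 1)]
      linarith [hn x x' y y']
    · intro ε hε
      obtain ⟨n₀, hn₀⟩ := hh ε hε
      refine ⟨n₀, fun n hn x => ?_⟩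
      convert hn₀ n hn x using 2
      simp only [throughAct_update, ContinuousMap.sub_apply, ContinuousMap.add_apply,
        ContinuousMap.const_apply]
      ring
    · intro x y hx hy
      refine huniq x y (fun z => ?_) fun z => ?_
      · have := hx z
        simp only [ContinuousMap.sub_apply, ContinuousMap.add_apply, ContinuousMap.const_apply,
          hφx] at this ⊢
        linarith
      · have := hy z
        simp only [ContinuousMap.sub_apply, ContinuousMap.add_apply, ContinuousMap.const_apply,
          hφx] at this ⊢
        linarith
  have hae := measure_eq_zero_iff_ae_notMem.1 hB0
  have hpull := (ae_of_ae_map (hη.prodMk (hm 0)).aemeasurable hae)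
  filter_upwards [hpull] with ω hω
  have : Function.update (η ω) 0 (ξ 0 ω) = fun j => ξ j ω := by simp [η]
  simpa [B, this] using hω

/-- Almost surely, minimizers are localized at every time and every scale. -/
theorem ae_forall_exists_localized (hm : ∀ j, Measurable (ξ j)) (hi : iIndepFun ξ μ)
    (hν : ∀ j, μ.map (ξ j) = ν) (hac : ν ≪ volume)
    (hF : Function.Injective fun x i => F i x) (β : X)
    (hpat : ∀ ε > 0, ∃ (N : ℕ) (g : ℤ → C(X, ℝ)), 0 < N ∧ (∀ j, g j ∈ uniformSupport ν F) ∧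
      Sep (dAct g β 0 N) ε) :
    ∀ᵐ ω ∂μ, ∀ k : ℤ, ∀ r > 0, ∃ n,
      Localized (fun j => kickC F (fun j => ξ j ω) (j + k)) β n r := by
  have h : ∀ (k : ℤ) (l : ℕ), ∀ᵐ ω ∂μ, ∃ n,
      Localized (kickC F fun j => ξ (j + k) ω) β n (1 / ((l : ℝ) + 1)) := fun k l => by
    have hi' := hi.precomp (g := fun j : ℤ => j + k) (add_left_injective k)
    exact ae_exists_localized (ξ := fun j => ξ (j + k)) (fun j => hm _) hi' (fun j => hν _) hac hF
      β (ae_exists_sep (fun j => hm _) hi' (fun j => hν _) β hpat) (by positivity)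
  filter_upwards [ae_all_iff.2 fun k => ae_all_iff.2 (h k)] with ω hω k r hr
  obtain ⟨l, hl⟩ := exists_nat_one_div_lt hr
  obtain ⟨n, hn⟩ := hω k l
  exact ⟨n, hn.mono hl.le⟩

end RandomKicks

/-! ### The torus -/

section TorusFacts

variable {d : ℕ}

theorem proj_add (v w : E d) : proj (v + w) = proj v + proj w := rfl

theorem proj_sub (v w : E d) : proj (v - w) = proj v - proj w := rfl

theorem proj_surjective (x : Torus d) : ∃ w, proj w = x := QuotientAddGroup.mk_surjective x

theorem proj_eq_proj {v w : E d} : proj v = proj w ↔ w - v ∈ lattice d := by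
  rw [proj, proj, QuotientAddGroup.eq, neg_add_eq_sub]

theorem continuous_proj : Continuous (proj : E d → Torus d) := continuous_quotient_mk'

theorem norm_proj_le (w : E d) : ‖proj w‖ ≤ ‖w‖ := QuotientAddGroup.norm_mk_le_norm

/-- Closedness makes the quotient norm separate points and be attained by a shortest representative.
-/
instance isClosed_lattice : IsClosed (lattice d : Set (E d)) := by
  have : (lattice d : Set (E d)) = ⋂ i, (fun x : E d => x i) ⁻¹' range ((↑) : ℤ → ℝ) := by
    ext x
    simp [lattice, eq_comm]
  rw [this]
  refine isClosed_iInter fun i => ?_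
  exact Int.isClosedEmbedding_coe_real.isClosed_range.preimage (by fun_prop)

theorem eq_of_norm_sub_eq_zero {x y : Torus d} (h : ‖x - y‖ = 0) : x = y := by
  obtain ⟨v, rfl⟩ := proj_surjective x
  obtain ⟨w, rfl⟩ := proj_surjective y
  rw [← proj_sub] at h
  have := (QuotientAddGroup.norm_mk_eq_zero (S := lattice d)).1 h
  exact (proj_eq_proj.2 this).symm

theorem exists_proj_eq_norm_eq (x : Torus d) : ∃ w, proj w = x ∧ ‖w‖ = ‖x‖ := by
  obtain ⟨v, rfl⟩ := proj_surjective x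
  obtain ⟨l, hl, hd⟩ := isClosed_lattice.exists_infDist_eq_dist (s := (lattice d : Set (E d)))
    ⟨0, (lattice d).zero_mem⟩ v
  refine ⟨v - l, ?_, ?_⟩
  · rw [proj_eq_proj]
    simpa using hl
  · rw [← dist_eq_norm, ← hd]
    exact (QuotientAddGroup.norm_mk (S := lattice d) v).symm

theorem exists_proj_eq_norm_le (x : Torus d) : ∃ w, proj w = x ∧ ‖w‖ ≤ √d := by
  obtain ⟨v, rfl⟩ := proj_surjective x
  refine ⟨WithLp.toLp 2 fun i => Int.fract (v i), ?_, ?_⟩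
  · rw [proj_eq_proj]
    intro i
    exact ⟨⌊v i⌋, by simp⟩
  · rw [EuclideanSpace.norm_eq]
    refine Real.sqrt_le_sqrt ?_
    refine (Finset.sum_le_card_nsmul _ _ 1 fun i _ => ?_).trans (by simp)
    have h0 := Int.fract_nonneg (v i)
    have h1 := (Int.fract_lt_one (v i)).le
    simp only [Real.norm_eq_abs, abs_of_nonneg h0]
    nlinarith

instance compactSpace_torus : CompactSpace (Torus d) := by
  refine ⟨?_⟩
  have : (univ : Set (Torus d)) = proj '' Metric.closedBall 0 (√d) := by
    ext x
    obtain ⟨w, hw, hn⟩ := exists_proj_eq_norm_le x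
    simp only [mem_univ, true_iff]
    exact ⟨w, by simpa using hn, hw⟩
  rw [this]
  exact (isCompact_closedBall _ _).image continuous_proj

theorem exists_nsmul_eq_norm_le (N : ℕ) (hN : 0 < N) (x : Torus d) :
    ∃ u, N • u = x ∧ ‖u‖ ≤ √d / N := by
  obtain ⟨w, rfl, hw⟩ := exists_proj_eq_norm_le x
  have hN' : (N : ℝ) ≠ 0 := by exact_mod_cast hN.ne'
  refine ⟨proj ((N : ℝ)⁻¹ • w), ?_, (norm_proj_le _).trans ?_⟩
  · have : N • proj ((N : ℝ)⁻¹ • w) = proj (N • ((N : ℝ)⁻¹ • w)) := rfl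
    rw [this, ← Nat.cast_smul_eq_nsmul ℝ, smul_inv_smul₀ hN']
  · rw [norm_smul, norm_inv, Real.norm_natCast, inv_mul_eq_div]
    gcongr

theorem continuous_of_continuous_lift {f : Torus d → ℝ} (h : Continuous (lift f)) :
    Continuous f :=
  continuous_quot_lift (f := lift f) (fun a b hab => congrArg f (Quot.sound hab)) h |>.congr
    fun x => by
      obtain ⟨w, rfl⟩ := proj_surjective x
      rfl

/-- Completing the square turns the linear term of the Lagrangian into a drift `b` and a constant,
which is why the discrete cost measures `y - x - β`. -/
theorem half_sq_sub_inner (b w : E d) :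
    1 / 2 * ‖w‖ ^ 2 - inner ℝ b w = 1 / 2 * ‖w - b‖ ^ 2 - 1 / 2 * ‖b‖ ^ 2 := by
  rw [norm_sub_sq_real, real_inner_comm]
  ring

theorem half_norm_proj_sq_le (b w : E d) :
    1 / 2 * ‖proj w - proj b‖ ^ 2 - 1 / 2 * ‖b‖ ^ 2 ≤ 1 / 2 * ‖w‖ ^ 2 - inner ℝ b w := by
  rw [half_sq_sub_inner]
  have := norm_proj_le (w - b)
  rw [proj_sub] at this
  gcongr

theorem exists_proj_eq_norm_sub_eq (b : E d) (x : Torus d) :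
    ∃ w, proj w = x ∧ ‖w - b‖ = ‖x - proj b‖ := by
  obtain ⟨w, hw, hn⟩ := exists_proj_eq_norm_eq (x - proj b)
  exact ⟨w + b, by rw [proj_add, hw, sub_add_cancel], by rw [add_sub_cancel_right, hn]⟩

end TorusFacts

/-! ### Kinetic action of a velocity field -/

section Kinetic

variable {d : ℕ}

/-- The kinetic part of the action of a curve with velocity `u`. -/
def kin (b : E d) (u : ℝ → E d) (s t : ℝ) : ℝ :=
  ∫ τ in s..t, ((1 / 2) * ‖u τ‖ ^ 2 - inner ℝ b (u τ))

/-- `u` and `‖u‖²` are integrable on `[s, t]`. -/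
def SqInt (u : ℝ → E d) (s t : ℝ) : Prop :=
  IntervalIntegrable u volume s t ∧ IntervalIntegrable (fun τ => ‖u τ‖ ^ 2) volume s t

theorem SqInt.mono {u : ℝ → E d} {s t s' t' : ℝ} (h : SqInt u s t) (hs : s ≤ s') (hst : s' ≤ t')
    (ht : t' ≤ t) : SqInt u s' t' := by
  have : uIcc s' t' ⊆ uIcc s t := by
    rw [uIcc_of_le hst, uIcc_of_le (hs.trans (hst.trans ht))]
    exact Icc_subset_Icc hs ht
  exact ⟨h.1.mono_set this, h.2.mono_set this⟩

theorem SqInt.trans {u : ℝ → E d} {s t r : ℝ} (h : SqInt u s t) (h' : SqInt u t r) : SqInt u s r :=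
  ⟨h.1.trans h'.1, h.2.trans h'.2⟩

theorem SqInt.congr {u u' : ℝ → E d} {s t : ℝ} (h : SqInt u s t) (hst : s ≤ t)
    (he : ∀ᵐ τ, τ ∈ Ioc s t → u τ = u' τ) : SqInt u' s t := by
  have he' : u =ᵐ[volume.restrict (uIoc s t)] u' := by
    rw [uIoc_of_le hst]
    exact (ae_restrict_iff' measurableSet_Ioc).2 he
  refine ⟨h.1.congr_ae he', h.2.congr_ae ?_⟩
  filter_upwards [he'] with τ hτ
  rw [hτ]

theorem kin_congr {b : E d} {u u' : ℝ → E d} {s t : ℝ} (hst : s ≤ t)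
    (he : ∀ᵐ τ, τ ∈ Ioc s t → u τ = u' τ) : kin b u s t = kin b u' s t := by
  refine intervalIntegral.integral_congr_ae ?_
  rw [uIoc_of_le hst]
  filter_upwards [he] with τ hτ hτ'
  rw [hτ hτ']

theorem SqInt.integrable_kin {u : ℝ → E d} {s t : ℝ} (h : SqInt u s t) (b : E d) :
    IntervalIntegrable (fun τ => (1 / 2) * ‖u τ‖ ^ 2 - inner ℝ b (u τ)) volume s t := by
  refine (h.2.const_mul _).sub ?_
  have := h.1
  rw [intervalIntegrable_iff] at this ⊢
  exact (innerSL ℝ b).integrable_comp this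

theorem kin_add {b : E d} {u : ℝ → E d} {s t r : ℝ} (h : SqInt u s t) (h' : SqInt u t r) :
    kin b u s t + kin b u t r = kin b u s r :=
  intervalIntegral.integral_add_adjacent_intervals (h.integrable_kin b) (h'.integrable_kin b)

theorem integral_inner_left {u : ℝ → E d} {s t : ℝ} (h : IntervalIntegrable u volume s t)
    (b : E d) : ∫ τ in s..t, inner ℝ b (u τ) = inner ℝ b (∫ τ in s..t, u τ) :=
  (innerSL ℝ b).intervalIntegral_comp_comm h

/-- Jensen's inequality, obtained by expanding the integral of the squared deviation of `u` from its
mean. -/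
theorem jensen_kin {b : E d} {u : ℝ → E d} {s t : ℝ} (h : SqInt u s t) (hst : s < t) :
    1 / (2 * (t - s)) * ‖∫ τ in s..t, u τ‖ ^ 2 - inner ℝ b (∫ τ in s..t, u τ) ≤ kin b u s t := by
  set W := ∫ τ in s..t, u τ with hW
  have hpos : 0 < t - s := by linarith
  have hi : ∀ c : E d, IntervalIntegrable (fun τ => inner ℝ c (u τ)) volume s t := fun c => by
    have := h.1
    rw [intervalIntegrable_iff] at this ⊢
    exact (innerSL ℝ c).integrable_comp this
  have h0 : 0 ≤ ∫ τ in s..t, ‖u τ - (t - s)⁻¹ • W‖ ^ 2 :=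
    intervalIntegral.integral_nonneg hst.le fun _ _ => by positivity
  have he : ∀ τ, ‖u τ - (t - s)⁻¹ • W‖ ^ 2 = ‖u τ‖ ^ 2 - 2 * inner ℝ ((t - s)⁻¹ • W) (u τ) +
      ‖(t - s)⁻¹ • W‖ ^ 2 := fun τ => by
    rw [norm_sub_sq_real, real_inner_comm]
  simp only [he] at h0
  rw [intervalIntegral.integral_add (h.2.sub ((hi _).const_mul _)) intervalIntegrable_const,
    intervalIntegral.integral_sub h.2 ((hi _).const_mul _), intervalIntegral.integral_const_mul,
    integral_inner_left h.1, ← hW, intervalIntegral.integral_const, inner_smul_left, norm_smul,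
    real_inner_self_eq_norm_sq, smul_eq_mul, Real.norm_of_nonneg (by positivity)] at h0
  simp only [conj_trivial] at h0
  rw [kin, intervalIntegral.integral_sub (h.2.const_mul _) (hi b),
    intervalIntegral.integral_const_mul, integral_inner_left h.1, ← hW]
  have e : (t - s) * ((t - s)⁻¹ * ‖W‖) ^ 2 = (t - s)⁻¹ * ‖W‖ ^ 2 := by field_simp
  rw [e] at h0
  have e2 : 1 / (2 * (t - s)) = 1 / 2 * (t - s)⁻¹ := by field_simp
  rw [e2]
  linarith

theorem AbsolutelyContinuousOnInterval.coord {g : ℝ → E d} {s t : ℝ}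
    (h : AbsolutelyContinuousOnInterval g s t) (i : Fin d) :
    AbsolutelyContinuousOnInterval (fun τ => g τ i) s t := by
  rw [absolutelyContinuousOnInterval_iff] at h ⊢
  intro ε hε
  obtain ⟨δ, hδ, H⟩ := h ε hε
  refine ⟨δ, hδ, fun I hI hlt => lt_of_le_of_lt ?_ (H I hI hlt)⟩
  refine Finset.sum_le_sum fun k _ => ?_
  rw [Real.dist_eq, dist_eq_norm]
  exact PiLp.norm_apply_le (g _ - g _) i

theorem Admissible.mono {g : ℝ → E d} {s t s' t' : ℝ} (h : Admissible s t g) (hs : s ≤ s')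
    (hst : s' ≤ t') (ht : t' ≤ t) : Admissible s' t' g := by
  have : uIcc s' t' ⊆ uIcc s t := by
    rw [uIcc_of_le hst, uIcc_of_le (hs.trans (hst.trans ht))]
    exact Icc_subset_Icc hs ht
  exact ⟨h.1.mono this, h.2.mono_set this⟩

theorem Admissible.sqInt {g : ℝ → E d} {s t : ℝ} (h : Admissible s t g) :
    SqInt (deriv g) s t := by
  refine ⟨?_, h.2⟩
  refine (intervalIntegrable_const (c := (1 : ℝ)) |>.add h.2).mono_fun
    (stronglyMeasurable_deriv g).aestronglyMeasurable ?_
  filter_upwards with τ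
  have h1 : 0 ≤ 1 + ‖deriv g τ‖ ^ 2 := by positivity
  rw [Real.norm_of_nonneg h1]
  nlinarith [sq_nonneg (‖deriv g τ‖ - 1), norm_nonneg (deriv g τ)]

/-- The fundamental theorem for scalar absolutely continuous functions is applied to each
coordinate. -/
theorem Admissible.integral_deriv {g : ℝ → E d} {s t : ℝ} (h : Admissible s t g) :
    ∫ τ in s..t, deriv g τ = g t - g s := by
  have hd : ∀ᵐ τ, τ ∈ uIoc s t → ∀ i, deriv (fun τ => g τ i) τ = deriv g τ i := by
    have := fun i => (AbsolutelyContinuousOnInterval.coord h.1 i).ae_differentiableAt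
    filter_upwards [ae_all_iff.2 this] with τ hτ hτ' i
    have hg : DifferentiableAt ℝ g τ :=
      differentiableAt_euclidean.2 fun i => hτ i (uIoc_subset_uIcc hτ')
    exact ((EuclideanSpace.proj (𝕜 := ℝ) i).hasFDerivAt.comp_hasDerivAt τ hg.hasDerivAt).deriv
  ext i
  have h1 := (AbsolutelyContinuousOnInterval.coord h.1 i).integral_deriv_eq_sub
  have h2 : ∫ τ in s..t, deriv g τ i = (∫ τ in s..t, deriv g τ) i :=
    (EuclideanSpace.proj (𝕜 := ℝ) i).intervalIntegral_comp_comm h.sqInt.1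
  rw [← h2, PiLp.sub_apply, ← h1]
  refine intervalIntegral.integral_congr_ae ?_
  filter_upwards [hd] with τ hτ hτ'
  exact (hτ hτ' i).symm

theorem action_eq_kin (f : ℤ → Torus d → ℝ) (b : E d) (s t : ℝ) (g : ℝ → E d) :
    action f b s t g =
      kin b (deriv g) s t - ∑ j ∈ Finset.Ico ⌈s⌉ ⌈t⌉, f j (proj (g j)) := rfl

theorem action_add {f : ℤ → Torus d → ℝ} {b : E d} {s t r : ℝ} {g : ℝ → E d} (hst : s ≤ t)
    (htr : t ≤ r) (h : Admissible s r g) :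
    action f b s t g + action f b t r g = action f b s r g := by
  rw [action_eq_kin, action_eq_kin, action_eq_kin,
    sum_Ico_consecutive_int _ (Int.ceil_mono hst) (Int.ceil_mono htr),
    ← kin_add (h.mono le_rfl hst htr).sqInt (h.mono hst htr le_rfl).sqInt]
  ring

/-- A discrete path below a velocity field is at most as costly. -/
theorem pathCost_le_kin (f : ℤ → C(Torus d, ℝ)) {b : E d} {u : ℝ → E d} {m n : ℤ} (hmn : m ≤ n)
    (hu : SqInt u m n) {G : ℤ → E d}
    (hG : ∀ j : ℤ, m ≤ j → j < n → G (j + 1) - G j = ∫ τ in (j : ℝ)..(j + 1 : ℤ), u τ) :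
    pathCost f (proj b) m n (fun j => proj (G j)) - (n - m) * (1 / 2 * ‖b‖ ^ 2) ≤
      kin b u m n - ∑ j ∈ Finset.Ico m n, f j (proj (G j)) := by
  induction n, hmn using Int.leInduction with
  | base => simp [pathCost, kin]
  | succ n hmn ih =>
    have hm : (m : ℝ) ≤ n := by exact_mod_cast hmn
    have hn : (n : ℝ) ≤ (n + 1 : ℤ) := by push_cast; linarith
    have hu₁ := hu.mono le_rfl hm hn
    have hu₂ := hu.mono hm hn le_rfl
    have ih := ih hu₁ fun j hj hj' => hG j hj (by omega)
    rw [pathCost_add f (proj b) hmn (by omega : n ≤ n + 1), pathCost_succ, stepCost,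
      sum_Ico_consecutive_int _ hmn (by omega : n ≤ n + 1), ← kin_add hu₁ hu₂]
    have hs : Finset.Ico n (n + 1) = {n} := by ext; simp; omega
    rw [hs, Finset.sum_singleton]
    have hj := jensen_kin (b := b) hu₂ (by push_cast; linarith)
    rw [← hG n hmn (by omega)] at hj
    have hp := half_norm_proj_sq_le b (G (n + 1) - G n)
    rw [proj_sub] at hp
    have e : (1 : ℝ) / (2 * ((n + 1 : ℤ) - n)) = 1 / 2 := by push_cast; norm_num
    rw [e] at hj
    push_cast at *
    linarith

end Kinetic

/-! ### Piecewise linear curves -/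

section Interpolation

variable {d : ℕ}

theorem exists_bound_floor {F : Type*} [NormedAddCommGroup F] (w : ℤ → F) (s t : ℝ) :
    ∃ C, ∀ τ ∈ Icc s t, ‖w ⌊τ⌋‖ ≤ C := by
  obtain ⟨C, hC⟩ := ((Finset.Icc ⌊s⌋ ⌊t⌋).image fun j => ‖w j‖).bddAbove
  refine ⟨C, fun τ hτ => hC ?_⟩
  simp only [Finset.coe_image, mem_image, Finset.coe_Icc]
  exact ⟨⌊τ⌋, ⟨Int.floor_mono hτ.1, Int.floor_mono hτ.2⟩, rfl⟩

theorem intervalIntegrable_floor {F : Type*} [NormedAddCommGroup F] (w : ℤ → F) (s t : ℝ) :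
    IntervalIntegrable (fun τ : ℝ => w ⌊τ⌋) volume s t := by
  wlog hst : s ≤ t generalizing s t
  · exact (this t s (le_of_not_ge hst)).symm
  rw [intervalIntegrable_iff_integrableOn_Ioc_of_le hst]
  obtain ⟨C, hC⟩ := exists_bound_floor w s t
  have hm : StronglyMeasurable fun τ : ℝ => w ⌊τ⌋ :=
    StronglyMeasurable.of_discrete.comp_measurable Int.measurable_floor
  refine Measure.integrableOn_of_bounded (M := C) measure_Ioc_lt_top.ne
    hm.aestronglyMeasurable ?_
  filter_upwards [ae_restrict_mem measurableSet_Ioc] with τ hτ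
  exact hC τ (Ioc_subset_Icc_self hτ)

/-- The curve starting from `p` at time `0` with velocity `w j` on `[j, j + 1)`. -/
def interp (p : E d) (w : ℤ → E d) (t : ℝ) : E d := p + ∫ τ in (0 : ℝ)..t, w ⌊τ⌋

theorem sqInt_floor (w : ℤ → E d) (s t : ℝ) : SqInt (fun τ => w ⌊τ⌋) s t :=
  ⟨intervalIntegrable_floor w s t, intervalIntegrable_floor (fun j => ‖w j‖ ^ 2) s t⟩

theorem interp_sub (p : E d) (w : ℤ → E d) (s t : ℝ) :
    interp p w t - interp p w s = ∫ τ in s..t, w ⌊τ⌋ := by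
  rw [interp, interp, add_sub_add_left_eq_sub, intervalIntegral.integral_interval_sub_left
    (intervalIntegrable_floor w _ _) (intervalIntegrable_floor w _ _)]

theorem ae_floor_eq (j : ℤ) : ∀ᵐ τ : ℝ, τ ∈ Icc (j : ℝ) (j + 1) → ⌊τ⌋ = j := by
  have : ∀ᵐ τ : ℝ, τ ≠ (j : ℝ) + 1 := by simp [ae_iff, measure_singleton]
  filter_upwards [this] with τ hτ hτ'
  exact Int.floor_eq_iff.2 ⟨hτ'.1, lt_of_le_of_ne hτ'.2 hτ⟩

theorem interp_sub_of_mem (p : E d) (w : ℤ → E d) {j : ℤ} {s t : ℝ} (hs : s ∈ Icc (j : ℝ) (j + 1))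
    (ht : t ∈ Icc (j : ℝ) (j + 1)) : interp p w t - interp p w s = (t - s) • w j := by
  rw [interp_sub, ← intervalIntegral.integral_const]
  refine intervalIntegral.integral_congr_ae ?_
  filter_upwards [ae_floor_eq j] with τ hτ hτ'
  rw [hτ]
  exact (uIcc_subset_Icc hs ht) (uIoc_subset_uIcc hτ')

theorem interp_succ (p : E d) (w : ℤ → E d) (j : ℤ) :
    interp p w (j + 1 : ℤ) - interp p w j = w j := by
  have := interp_sub_of_mem p w (j := j) (s := j) (t := (j + 1 : ℤ)) (by simp) (by simp)
  simpa using this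

/-- The left derivative at `j` sees the segment on `[j - 1, j]`, hence the index `j - 1`. -/
theorem hasDerivWithinAt_interp (p : E d) (w : ℤ → E d) (j : ℤ) :
    HasDerivWithinAt (interp p w) (w (j - 1)) (Iic (j : ℝ)) j := by
  have h : HasDerivAt (fun t : ℝ => interp p w j + (t - j) • w (j - 1)) (w (j - 1)) j := by
    have := (((hasDerivAt_id (j : ℝ)).sub_const (j : ℝ)).smul_const (w (j - 1))).const_add
      (interp p w j)
    simpa using this
  refine h.hasDerivWithinAt.congr_of_eventuallyEq ?_ (by simp)
  have hnear : ∀ᶠ t : ℝ in 𝓝[Iic (j : ℝ)] j, t ∈ Icc ((j - 1 : ℤ) : ℝ) ((j - 1 : ℤ) + 1) := by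
    have h1 : ∀ᶠ t : ℝ in 𝓝[Iic (j : ℝ)] j, (j : ℝ) - 1 < t :=
      mem_nhdsWithin_of_mem_nhds (lt_mem_nhds (by linarith))
    filter_upwards [h1, self_mem_nhdsWithin] with t ht ht'
    have : t ≤ j := ht'
    push_cast
    constructor <;> linarith
  filter_upwards [hnear] with t ht
  have := interp_sub_of_mem p w (j := j - 1) (s := j) (t := t) (by push_cast; simp) ht
  rw [← this]
  abel

theorem ae_deriv_interp (p : E d) (w : ℤ → E d) : ∀ᵐ τ : ℝ, deriv (interp p w) τ = w ⌊τ⌋ := by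
  have hZ : volume (range ((↑) : ℤ → ℝ)) = 0 := (countable_range _).measure_zero _
  have : ∀ᵐ τ : ℝ, τ ∉ range ((↑) : ℤ → ℝ) := measure_eq_zero_iff_ae_notMem.1 hZ
  filter_upwards [this] with τ hτ
  have h1 : (⌊τ⌋ : ℝ) < τ := lt_of_le_of_ne (Int.floor_le τ) fun h => hτ ⟨_, h⟩
  have h2 := Int.lt_floor_add_one τ
  have h : HasDerivAt (fun t : ℝ => interp p w τ + (t - τ) • w ⌊τ⌋) (w ⌊τ⌋) τ := by
    have := (((hasDerivAt_id τ).sub_const τ).smul_const (w ⌊τ⌋)).const_add (interp p w τ)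
    simpa using this
  refine (h.congr_of_eventuallyEq ?_).deriv
  filter_upwards [Ioo_mem_nhds h1 h2] with t ht
  have := interp_sub_of_mem p w (j := ⌊τ⌋) (s := τ) (t := t) ⟨h1.le, h2.le⟩ ⟨ht.1.le, ht.2.le⟩
  rw [← this]
  abel

theorem admissible_interp (p : E d) (w : ℤ → E d) {s t : ℝ} (hst : s ≤ t) :
    Admissible s t (interp p w) := by
  obtain ⟨C, hC⟩ := exists_bound_floor w s t
  have hC0 : 0 ≤ C := (norm_nonneg _).trans (hC s ⟨le_rfl, hst⟩)
  constructor
  · refine LipschitzOnWith.absolutelyContinuousOnInterval (K := ⟨C, hC0⟩) ?_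
    refine LipschitzOnWith.of_dist_le_mul fun x hx y hy => ?_
    rw [dist_eq_norm, interp_sub, Real.dist_eq, abs_sub_comm, abs_sub_comm]
    refine intervalIntegral.norm_integral_le_of_norm_le_const fun τ hτ => hC τ ?_
    rw [uIcc_of_le hst] at hx hy
    exact uIcc_subset_Icc hy hx (uIoc_subset_uIcc hτ)
  · refine ((sqInt_floor w s t).congr hst ?_).2
    filter_upwards [ae_deriv_interp p w] with τ hτ _ using hτ.symm

theorem kin_interp (b p : E d) (w : ℤ → E d) {s t : ℝ} (hst : s ≤ t) :
    kin b (deriv (interp p w)) s t = kin b (fun τ => w ⌊τ⌋) s t := by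
  refine kin_congr hst ?_
  filter_upwards [ae_deriv_interp p w] with τ hτ _ using hτ

theorem kin_floor_succ (b : E d) (w : ℤ → E d) (j : ℤ) :
    kin b (fun τ => w ⌊τ⌋) j (j + 1 : ℤ) = 1 / 2 * ‖w j‖ ^ 2 - inner ℝ b (w j) := by
  have : kin b (fun τ => w ⌊τ⌋) j (j + 1 : ℤ) = kin b (fun _ => w j) j (j + 1 : ℤ) := by
    refine kin_congr (by push_cast; linarith) ?_
    filter_upwards [ae_floor_eq j] with τ hτ hτ'
    rw [hτ]
    have := Ioc_subset_Icc_self hτ'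
    push_cast at this
    exact this
  rw [this, kin, intervalIntegral.integral_const]
  simp

theorem proj_interp {p : E d} {w : ℤ → E d} {z : ℤ → Torus d} (hp : proj p = z 0)
    (hw : ∀ j, proj (w j) = z (j + 1) - z j) (j : ℤ) : proj (interp p w j) = z j := by
  have hs : ∀ j : ℤ, proj (interp p w (j + 1 : ℤ)) = proj (interp p w j) + (z (j + 1) - z j) := by
    intro j
    rw [← hw, ← proj_add, ← interp_succ p w j, add_sub_cancel]
  induction j using Int.induction_on with
  | zero => simp [interp, hp]
  | succ k ih => rw [hs, ih, add_sub_cancel]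
  | pred k ih =>
    have h := hs (-k - 1)
    rw [sub_add_cancel, ih] at h
    rw [eq_sub_of_add_eq h.symm]
    abel

/-- The action of an optimal piecewise linear curve is the cost of the discrete path. -/
theorem kin_floor_eq_pathCost (f : ℤ → C(Torus d, ℝ)) (b : E d) {w : ℤ → E d} {z : ℤ → Torus d}
    (hw : ∀ j, ‖w j - b‖ = ‖z (j + 1) - z j - proj b‖) {m n : ℤ} (hmn : m ≤ n) :
    kin b (fun τ => w ⌊τ⌋) m n - ∑ j ∈ Finset.Ico m n, f j (z j) =
      pathCost f (proj b) m n z - (n - m) * (1 / 2 * ‖b‖ ^ 2) := by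
  induction n, hmn using Int.leInduction with
  | base => simp [pathCost, kin]
  | succ n hmn ih =>
    have hs : Finset.Ico n (n + 1) = {n} := by ext; simp; omega
    rw [pathCost_add f (proj b) hmn (by omega : n ≤ n + 1), pathCost_succ, stepCost,
      sum_Ico_consecutive_int _ hmn (by omega : n ≤ n + 1),
      ← kin_add (sqInt_floor w m n) (sqInt_floor w n _), kin_floor_succ, half_sq_sub_inner, hw,
      hs, Finset.sum_singleton]
    push_cast
    linarith

end Interpolation

/-! ### Discrete and continuous minimizers -/

section Minimizers

variable {d : ℕ} (f : ℤ → C(Torus d, ℝ)) (b : E d)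

theorem dAct_le_action {m n : ℤ} (hmn : m ≤ n) {g : ℝ → E d} (hg : Admissible m n g) :
    dAct f (proj b) m n (proj (g m)) (proj (g n)) - (n - m) * (1 / 2 * ‖b‖ ^ 2) ≤
      action (fun j => f j) b m n g := by
  have h := pathCost_le_kin f hmn (b := b) hg.sqInt (G := fun j : ℤ => g j) fun j hj hj' => by
    have h1 : (m : ℝ) ≤ j := by exact_mod_cast hj
    have h2 : ((j + 1 : ℤ) : ℝ) ≤ n := by exact_mod_cast hj'
    exact (hg.mono h1 (by push_cast; linarith) h2).integral_deriv.symm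
  have h' := dAct_le_pathCost f (proj b) m n fun j => proj (g j)
  rw [action_eq_kin, Int.ceil_intCast, Int.ceil_intCast]
  linarith

/-- A lift, by an optimal piecewise linear curve, of a discrete path. -/
theorem exists_interp_lift (z : ℤ → Torus d) : ∃ (p : E d) (w : ℤ → E d),
    (∀ j : ℤ, proj (interp p w j) = z j) ∧ ∀ j, ‖w j - b‖ = ‖z (j + 1) - z j - proj b‖ := by
  obtain ⟨p, hp⟩ := proj_surjective (z 0)
  choose w hw hwn using fun j => exists_proj_eq_norm_sub_eq b (z (j + 1) - z j)
  exact ⟨p, w, proj_interp hp hw, hwn⟩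

theorem bddBelow_actions {s t : ℝ} (hst : s < t) (x y : Torus d) :
    BddBelow {a : ℝ | ∃ g : ℝ → E d, Admissible s t g ∧ proj (g s) = x ∧ proj (g t) = y ∧
      a = action (fun j => f j) b s t g} := by
  choose C hC using fun j => isCompact_univ.exists_bound_of_continuousOn
    (f j).continuous.continuousOn
  refine ⟨-((t - s) * (1 / 2 * ‖b‖ ^ 2)) - ∑ j ∈ Finset.Ico ⌈s⌉ ⌈t⌉, C j, ?_⟩
  rintro a ⟨g, hg, -, -, rfl⟩
  rw [action_eq_kin]
  have h1 : ∑ j ∈ Finset.Ico ⌈s⌉ ⌈t⌉, f j (proj (g j)) ≤ ∑ j ∈ Finset.Ico ⌈s⌉ ⌈t⌉, C j :=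
    Finset.sum_le_sum fun j _ => (le_abs_self _).trans (hC j _ (mem_univ _))
  have h2 : -((t - s) * (1 / 2 * ‖b‖ ^ 2)) ≤ kin b (deriv g) s t := by
    have : ∫ _ in s..t, (-(1 / 2 * ‖b‖ ^ 2)) ≤ kin b (deriv g) s t :=
      intervalIntegral.integral_mono_on hst.le intervalIntegrable_const
        (hg.sqInt.integrable_kin b) fun τ _ => by
          rw [half_sq_sub_inner]
          have : 0 ≤ ‖deriv g τ - b‖ ^ 2 := by positivity
          linarith
    rw [intervalIntegral.integral_const, smul_eq_mul] at this
    linarith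
  linarith

theorem actionFn_le_action {s t : ℝ} (hst : s < t) {g : ℝ → E d} (hg : Admissible s t g) :
    actionFn (fun j => f j) b s t (proj (g s)) (proj (g t)) ≤ action (fun j => f j) b s t g :=
  csInf_le (bddBelow_actions f b hst _ _) ⟨g, hg, rfl, rfl, rfl⟩

/-- Jensen on unit intervals gives the lower bound. It is attained by the piecewise linear lift of
an optimal path whose increments are the representatives closest to `b`. -/
theorem actionFn_eq_dAct {m n : ℤ} (hmn : m < n) (x y : Torus d) :
    actionFn (fun j => f j) b m n x y =
      dAct f (proj b) m n x y - (n - m) * (1 / 2 * ‖b‖ ^ 2) := by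
  have hmn' : (m : ℝ) < n := by exact_mod_cast hmn
  obtain ⟨z, rfl, rfl, hz⟩ := exists_pathCost_eq f (proj b) hmn x y
  obtain ⟨p, w, hp, hw⟩ := exists_interp_lift b z
  have hadm := admissible_interp p w hmn'.le
  refine le_antisymm ?_ ?_
  · have h := actionFn_le_action f b hmn' hadm
    rw [action_eq_kin, kin_interp b p w hmn'.le, Int.ceil_intCast, Int.ceil_intCast] at h
    simp only [hp] at h
    rwa [kin_floor_eq_pathCost f b hw hmn.le, hz] at h
  · refine le_csInf ⟨_, _, hadm, hp m, hp n, rfl⟩ ?_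
    rintro a ⟨g, hg, h1, h2, rfl⟩
    rw [← h1, ← h2]
    exact dAct_le_action f b hmn.le hg

/-- An optimal piecewise linear lift of a minimizing discrete path is a minimizing curve. -/
theorem isMinimizingCurve_interp {z : ℤ → Torus d} (hz : ∀ m n : ℤ, m < n →
    pathCost f (proj b) m n z = dAct f (proj b) m n (z m) (z n)) {p : E d} {w : ℤ → E d}
    (hp : ∀ j : ℤ, proj (interp p w j) = z j)
    (hw : ∀ j, ‖w j - b‖ = ‖z (j + 1) - z j - proj b‖) :
    IsMinimizingCurve (fun j => f j) b univ (interp p w) := by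
  intro s t hst _
  have hadm := admissible_interp p w hst.le
  refine ⟨hadm, le_antisymm ?_ (actionFn_le_action f b hst hadm)⟩
  refine le_csInf ⟨_, _, hadm, rfl, rfl, rfl⟩ ?_
  rintro a ⟨g, hg, hgs, hgt, rfl⟩
  set m := ⌊s⌋
  set n := ⌈t⌉
  have hms : (m : ℝ) ≤ s := Int.floor_le s
  have htn : t ≤ n := Int.le_ceil t
  have hmn : m < n := by
    have : (m : ℝ) < n := hms.trans_lt (hst.trans_le htn)
    exact_mod_cast this
  have hmc : m ≤ ⌈s⌉ := Int.floor_le_ceil s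
  have hcn : ⌈s⌉ ≤ n := Int.ceil_mono hst.le
  -- The competitor is spliced into the polygonal curve on the integer interval `[m, n]`, where
  -- minimality is known. Splicing velocities rather than curves lets the lifts differ by a lattice
  -- vector.
  let u : ℝ → E d := fun τ => if τ ∈ Ioc s t then deriv g τ else w ⌊τ⌋
  have hu₁ : ∀ᵐ τ : ℝ, τ ∈ Ioc (m : ℝ) s → w ⌊τ⌋ = u τ := by
    filter_upwards with τ hτ
    simp [u, not_lt.2 hτ.2]
  have hu₂ : ∀ᵐ τ : ℝ, τ ∈ Ioc s t → deriv g τ = u τ := by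
    filter_upwards with τ hτ
    simp only [u, if_pos hτ]
  have hu₃ : ∀ᵐ τ : ℝ, τ ∈ Ioc t n → w ⌊τ⌋ = u τ := by
    filter_upwards with τ hτ
    simp [u, not_le.2 hτ.1]
  have hi₁ := (sqInt_floor w m s).congr hms hu₁
  have hi₂ := hg.sqInt.congr hst.le hu₂
  have hi₃ := (sqInt_floor w t n).congr htn hu₃
  have hint : SqInt u m n := (hi₁.trans hi₂).trans hi₃
  have hsub : ∀ {a c : ℝ}, (m : ℝ) ≤ a → a ≤ c → c ≤ n → IntervalIntegrable u volume a c :=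
    fun h1 h2 h3 => (hint.mono h1 h2 h3).1
  have hcongr : ∀ {a c : ℝ} {v : ℝ → E d}, a ≤ c → (∀ᵐ τ : ℝ, τ ∈ Ioc a c → v τ = u τ) →
      ∫ τ in a..c, u τ = ∫ τ in a..c, v τ := fun {a c v} hac h =>
    intervalIntegral.integral_congr_ae (by
      rw [uIoc_of_le hac]
      filter_upwards [h] with τ hτ hτ' using (hτ hτ').symm)
  let G : ℝ → E d := fun r => interp p w m + ∫ τ in (m : ℝ)..r, u τ
  have hGs : G s = interp p w s := by
    simp only [G]
    rw [hcongr hms hu₁, ← interp_sub p w, add_sub_cancel]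
  have hGmid : ∀ r, s ≤ r → r ≤ t → G r = G s + (g r - g s) := fun r hr hr' => by
    have h1 : ∫ τ in s..r, u τ = g r - g s := by
      rw [hcongr hr (v := deriv g), (hg.mono le_rfl hr hr').integral_deriv]
      filter_upwards [hu₂] with τ hτ hτ' using hτ ⟨hτ'.1, hτ'.2.trans hr'⟩
    simp only [G]
    rw [← intervalIntegral.integral_add_adjacent_intervals (hsub le_rfl hms (hst.le.trans htn))
      (hsub hms hr (hr'.trans htn)), h1, add_assoc]
  have hGn : G n = G t + (interp p w n - interp p w t) := by
    simp only [G]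
    rw [← intervalIntegral.integral_add_adjacent_intervals (hsub le_rfl (hms.trans hst.le) htn)
      (hsub (hms.trans hst.le) htn le_rfl), hcongr htn hu₃, ← interp_sub p w, add_assoc]
  have hpmid : ∀ r, s ≤ r → r ≤ t → proj (G r) = proj (g r) := fun r hr hr' => by
    rw [hGmid r hr hr', hGs, proj_add, proj_sub, hgs]
    abel
  have hpm : proj (G m) = z m := by simp [G, hp]
  have hpn : proj (G n) = z n := by
    rw [hGn, proj_add, hpmid t hst.le le_rfl, hgt, proj_sub, hp]
    abel
  have hlow := pathCost_le_kin f hmn.le (b := b) hint (G := fun j : ℤ => G j) fun j hj hj' => by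
    have h1 : (m : ℝ) ≤ j := by exact_mod_cast hj
    have h2 : ((j + 1 : ℤ) : ℝ) ≤ n := by exact_mod_cast hj'
    have h3 : (j : ℝ) ≤ (j + 1 : ℤ) := by push_cast; linarith
    simp only [G]
    rw [add_sub_add_left_eq_sub, intervalIntegral.integral_interval_sub_left
      (hsub le_rfl (h1.trans h3) h2) (hsub le_rfl h1 (h3.trans h2))]
  have hd := dAct_le_pathCost f (proj b) m n fun j => proj (G j)
  simp only [hpm, hpn] at hd
  rw [← hz m n hmn] at hd
  have hup := kin_floor_eq_pathCost f b hw hmn.le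
  rw [← kin_add (hi₁.trans hi₂) hi₃, ← kin_add hi₁ hi₂, ← kin_congr hms hu₁,
    ← kin_congr hst.le hu₂, ← kin_congr htn hu₃] at hlow
  rw [← kin_add (sqInt_floor w m t) (sqInt_floor w t n),
    ← kin_add (sqInt_floor w m s) (sqInt_floor w s t)] at hup
  -- The only integer that can occur here is `m = ⌊s⌋`.
  have hk₁ : ∑ j ∈ Finset.Ico m ⌈s⌉, f j (proj (G j)) = ∑ j ∈ Finset.Ico m ⌈s⌉, f j (z j) := by
    refine Finset.sum_congr rfl fun j hj => ?_
    rw [Finset.mem_Ico] at hj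
    have h1 : (j : ℝ) < s := Int.lt_ceil.1 hj.2
    have h2 : j = m := by
      have : j ≤ m := Int.le_floor.2 h1.le
      omega
    rw [h2, hpm]
  have hk₂ : ∑ j ∈ Finset.Ico ⌈s⌉ n, f j (proj (G j)) =
      ∑ j ∈ Finset.Ico ⌈s⌉ n, f j (proj (g j)) := by
    refine Finset.sum_congr rfl fun j hj => ?_
    rw [Finset.mem_Ico] at hj
    rw [hpmid j (Int.ceil_le.1 hj.1) (Int.lt_ceil.1 hj.2).le]
  rw [sum_Ico_consecutive_int _ hmc hcn, hk₁, hk₂] at hlow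
  rw [sum_Ico_consecutive_int _ hmc hcn] at hup
  rw [action_eq_kin, action_eq_kin, kin_interp b p w hst.le]
  simp only [hp]
  linarith

variable {f b}

theorem IsMinimizingCurve.mono {f : ℤ → Torus d → ℝ} {I J : Set ℝ} {g : ℝ → E d}
    (h : IsMinimizingCurve f b I g) (hJ : J ⊆ I) : IsMinimizingCurve f b J g :=
  fun s t hst hI => h s t hst (hI.trans hJ)

/-- Positions of a minimizing curve at integer times form a minimizing path. -/
theorem IsMinimizingCurve.dAct_add_le {g : ℝ → E d} {m k n : ℤ} (hmk : m < k) (hkn : k < n)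
    (hg : IsMinimizingCurve (fun j => f j) b (Icc (m : ℝ) n) g) (x : Torus d) :
    dAct f (proj b) m k (proj (g m)) (proj (g k)) + dAct f (proj b) k n (proj (g k)) (proj (g n)) ≤
      dAct f (proj b) m k (proj (g m)) x + dAct f (proj b) k n x (proj (g n)) := by
  have hmk' : (m : ℝ) < k := by exact_mod_cast hmk
  have hkn' : (k : ℝ) < n := by exact_mod_cast hkn
  obtain ⟨ha, h⟩ := hg m n (hmk'.trans hkn') Subset.rfl
  have h₁ := dAct_le_action f b hmk.le (ha.mono le_rfl hmk'.le hkn'.le)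
  have h₂ := dAct_le_action f b hkn.le (ha.mono hmk'.le hkn'.le le_rfl)
  rw [← action_add hmk'.le hkn'.le ha, actionFn_eq_dAct f b (hmk.trans hkn)] at h
  have := dAct_triangle f (proj b) hmk hkn (proj (g m)) x (proj (g n))
  linarith

/-- A minimizing curve on a unit interval is an optimal straight line. -/
theorem IsMinimizingCurve.velocity {g : ℝ → E d} {j : ℤ} {v : E d}
    (hg : IsMinimizingCurve (fun j => f j) b (Icc (j : ℝ) (j + 1 : ℤ)) g)
    (hv : HasDerivWithinAt g v (Iic ((j + 1 : ℤ) : ℝ)) (j + 1 : ℤ)) :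
    v = g (j + 1 : ℤ) - g j ∧
      ‖v - b‖ = ‖proj (g (j + 1 : ℤ)) - proj (g j) - proj b‖ := by
  have hlt : (j : ℝ) < (j + 1 : ℤ) := by push_cast; linarith
  have hlen : ((j + 1 : ℤ) : ℝ) - j = 1 := by push_cast; ring
  obtain ⟨ha, h⟩ := hg j (j + 1 : ℤ) hlt Subset.rfl
  have hs : Finset.Ico j (j + 1) = {j} := by ext; simp; omega
  set W := g (j + 1 : ℤ) - g j with hW
  rw [actionFn_eq_dAct f b (by omega : j < j + 1), dAct_succ, stepCost, action_eq_kin,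
    Int.ceil_intCast, Int.ceil_intCast, hs, Finset.sum_singleton] at h
  have hkin : kin b (deriv g) j (j + 1 : ℤ) =
      1 / 2 * ‖proj (g (j + 1 : ℤ)) - proj (g j) - proj b‖ ^ 2 - 1 / 2 * ‖b‖ ^ 2 := by
    rw [hlen] at h
    linarith
  have hlow := half_norm_proj_sq_le b W
  rw [hW, proj_sub, ← hW] at hlow
  have hline : ∀ s : ℝ, (j : ℝ) < s → s < (j + 1 : ℤ) →
      g (j + 1 : ℤ) - g s = ((j + 1 : ℤ) - s) • W := by
    intro s hs₁ hs₂
    have ha₁ := ha.mono le_rfl hs₁.le hs₂.le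
    have ha₂ := ha.mono hs₁.le hs₂.le le_rfl
    have j₁ := jensen_kin (b := b) ha₁.sqInt hs₁
    have j₂ := jensen_kin (b := b) ha₂.sqInt hs₂
    rw [ha₁.integral_deriv] at j₁
    rw [ha₂.integral_deriv] at j₂
    have hsum := kin_add (b := b) ha₁.sqInt ha₂.sqInt
    set w₂ := g (j + 1 : ℤ) - g s
    have e₁ : g s - g j = W - w₂ := by simp only [W, w₂]; abel
    rw [e₁, inner_sub_right, norm_sub_sq_real] at j₁
    set θ : ℝ := (j + 1 : ℤ) - s with hθ
    have e₂ : s - j = 1 - θ := by rw [hθ]; push_cast; ring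
    have hθ0 : 0 < θ := by linarith
    have hθ1 : 0 < 1 - θ := by linarith
    rw [e₂] at j₁
    have hzero : ‖w₂ - θ • W‖ ^ 2 = 0 := by
      refine le_antisymm ?_ (by positivity)
      have hn : ‖w₂ - θ • W‖ ^ 2 = ‖w₂‖ ^ 2 - 2 * θ * inner ℝ W w₂ + θ ^ 2 * ‖W‖ ^ 2 := by
        rw [norm_sub_sq_real, inner_smul_right, real_inner_comm, norm_smul,
          Real.norm_of_nonneg hθ0.le]
        ring
      have hq : 1 / (2 * (1 - θ)) * (‖W‖ ^ 2 - 2 * inner ℝ W w₂ + ‖w₂‖ ^ 2) +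
          1 / (2 * θ) * ‖w₂‖ ^ 2 ≤ 1 / 2 * ‖W‖ ^ 2 := by linarith
      -- The excess of the Jensen bounds on the two pieces over that of the whole segment is a
      -- positive multiple of `‖w₂ - θ • W‖ ^ 2`, so minimality forces the curve to be straight.
      have e : 1 / (2 * (1 - θ)) * (‖W‖ ^ 2 - 2 * inner ℝ W w₂ + ‖w₂‖ ^ 2) +
          1 / (2 * θ) * ‖w₂‖ ^ 2 - 1 / 2 * ‖W‖ ^ 2 =
          1 / (2 * θ * (1 - θ)) *
            (‖w₂‖ ^ 2 - 2 * θ * inner ℝ W w₂ + θ ^ 2 * ‖W‖ ^ 2) := by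
        field_simp
        ring
      rw [hn]
      have hpos : 0 < 1 / (2 * θ * (1 - θ)) := by positivity
      by_contra! hc
      have := mul_pos hpos hc
      linarith
    rw [sq_eq_zero_iff, norm_eq_zero, sub_eq_zero] at hzero
    exact hzero
  have hvW : v = W := by
    have hd : HasDerivWithinAt g W (Ioc (j : ℝ) (j + 1 : ℤ)) (j + 1 : ℤ) := by
      have h1 : HasDerivAt (fun s : ℝ => g (j + 1 : ℤ) + (s - (j + 1 : ℤ)) • W) W (j + 1 : ℤ) := by
        have := (((hasDerivAt_id ((j + 1 : ℤ) : ℝ)).sub_const ((j + 1 : ℤ) : ℝ)).smul_const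
          W).const_add (g (j + 1 : ℤ))
        simpa using this
      refine h1.hasDerivWithinAt.congr (fun s hs => ?_) (by simp)
      rcases hs.2.eq_or_lt with rfl | hs₂
      · simp
      rw [← neg_sub ((j + 1 : ℤ) : ℝ), neg_smul, ← hline s hs.1 hs₂]
      abel
    have hv' : HasDerivWithinAt g v (Ioc (j : ℝ) (j + 1 : ℤ)) (j + 1 : ℤ) :=
      hv.mono fun s hs => hs.2
    exact (uniqueDiffOn_Ioc (j : ℝ) _ _ ⟨hlt, le_rfl⟩).eq_deriv _ hv' hd
  refine ⟨hvW, ?_⟩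
  rw [hvW]
  have j₀ := jensen_kin (b := b) ha.sqInt hlt
  rw [ha.integral_deriv, hlen, hkin, ← hW, mul_one, half_sq_sub_inner] at j₀
  rw [half_sq_sub_inner] at hlow
  have : ‖W - b‖ ^ 2 = ‖proj (g (j + 1 : ℤ)) - proj (g j) - proj b‖ ^ 2 := by linarith
  exact (sq_eq_sq₀ (norm_nonneg _) (norm_nonneg _)).1 this

/-- The first order condition at an intermediate point of a minimizing path. -/
theorem velocity_unique {φ : Torus d → ℝ} {x₀ x₁ x₂ : Torus d}
    (hφ : Differentiable ℝ (lift φ))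
    (hmin : ∀ y, 1 / 2 * ‖x₁ - x₀ - proj b‖ ^ 2 + (1 / 2 * ‖x₂ - x₁ - proj b‖ ^ 2 - φ x₁) ≤
      1 / 2 * ‖y - x₀ - proj b‖ ^ 2 + (1 / 2 * ‖x₂ - y - proj b‖ ^ 2 - φ y))
    {v v' w : E d} (hv : proj v = x₁ - x₀) (hvn : ‖v - b‖ = ‖x₁ - x₀ - proj b‖)
    (hv' : proj v' = x₁ - x₀) (hvn' : ‖v' - b‖ = ‖x₁ - x₀ - proj b‖)
    (hw : proj w = x₂ - x₁) (hwn : ‖w - b‖ = ‖x₂ - x₁ - proj b‖) : v = v' := by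
  obtain ⟨p, rfl⟩ := proj_surjective x₁
  obtain ⟨D, hD⟩ : ∃ D : E d →L[ℝ] ℝ, HasFDerivAt (fun h : E d => φ (proj (p + h))) D 0 := by
    refine ⟨fderiv ℝ (lift φ) p, ?_⟩
    have h1 : HasFDerivAt (fun h : E d => p + h) (ContinuousLinearMap.id ℝ (E d)) 0 :=
      (hasFDerivAt_id (𝕜 := ℝ) (0 : E d)).const_add p
    have h2 : HasFDerivAt (lift φ) (fderiv ℝ (lift φ) p) (p + 0) := by
      rw [add_zero]
      exact (hφ p).hasFDerivAt
    exact h2.comp (0 : E d) h1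
  have key : ∀ v : E d, proj v = proj p - x₀ → ‖v - b‖ = ‖proj p - x₀ - proj b‖ →
      ∀ h, inner ℝ (v - b) h - inner ℝ (w - b) h - D h = 0 := by
    intro v hv hvn
    -- With fixed lifts, `ψ` dominates the true cost and equals it at `h = 0`, so it inherits the
    -- minimum and is differentiable there even where the torus distance is not. Its critical
    -- equation determines `v` from `w` and `D`.
    let ψ : E d → ℝ := fun h => 1 / 2 * ‖(v - b) + h‖ ^ 2 + 1 / 2 * ‖(w - b) - h‖ ^ 2 -
      φ (proj (p + h))
    have hloc : IsLocalMin ψ 0 := by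
      refine Filter.Eventually.of_forall fun h => ?_
      have h1 := hmin (proj (p + h))
      have h2 : ‖proj (p + h) - x₀ - proj b‖ ≤ ‖(v - b) + h‖ := by
        refine le_of_eq_of_le ?_ (norm_proj_le _)
        rw [proj_add, proj_add, proj_sub, hv]
        congr 1
        abel
      have h3 : ‖x₂ - proj (p + h) - proj b‖ ≤ ‖(w - b) - h‖ := by
        refine le_of_eq_of_le ?_ (norm_proj_le _)
        rw [proj_add, proj_sub, proj_sub, hw]
        congr 1
        abel
      have h4 : ‖proj (p + h) - x₀ - proj b‖ ^ 2 ≤ ‖(v - b) + h‖ ^ 2 := by gcongr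
      have h5 : ‖x₂ - proj (p + h) - proj b‖ ^ 2 ≤ ‖(w - b) - h‖ ^ 2 := by gcongr
      simp only [ψ, add_zero, sub_zero, hvn, hwn]
      linarith
    have hd : HasFDerivAt ψ (innerSL ℝ (v - b) - innerSL ℝ (w - b) - D) 0 := by
      have e : ψ = fun h => (1 / 2 * ‖v - b‖ ^ 2 + 1 / 2 * ‖w - b‖ ^ 2) + innerSL ℝ (v - b) h -
          innerSL ℝ (w - b) h + ‖h‖ ^ 2 - φ (proj (p + h)) := by
        funext h
        simp only [ψ, innerSL_apply_apply]
        rw [norm_add_sq_real (v - b), norm_sub_sq_real (w - b)]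
        ring
      rw [e]
      have hsq : HasFDerivAt (fun h : E d => ‖h‖ ^ 2) (0 : E d →L[ℝ] ℝ) 0 := by
        simpa using (hasStrictFDerivAt_norm_sq (0 : E d)).hasFDerivAt
      have := (((((innerSL ℝ (v - b)).hasFDerivAt (x := 0)).const_add
        (1 / 2 * ‖v - b‖ ^ 2 + 1 / 2 * ‖w - b‖ ^ 2)).fun_sub
        ((innerSL ℝ (w - b)).hasFDerivAt (x := 0))).fun_add hsq).fun_sub hD
      exact this.congr_fderiv (by rw [add_zero])
    intro h
    exact DFunLike.congr_fun (hloc.hasFDerivAt_eq_zero hd) h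
  rw [← sub_eq_zero]
  refine ext_inner_right ℝ fun h => ?_
  have h1 := key v hv hvn h
  have h2 := key v' hv' hvn' h
  rw [inner_zero_left]
  simp only [inner_sub_left] at h1 h2 ⊢
  linarith

end Minimizers

/-! ### Global minimizers -/

theorem pathCost_eq_dAct_of_subinterval {X : Type*} [SeminormedAddCommGroup X] [CompactSpace X]
    {f : ℤ → C(X, ℝ)} {β : X} {m m' n' n : ℤ} (hm : m ≤ m') (hmn : m' < n') (hn : n' ≤ n)
    {z : ℤ → X} (h : pathCost f β m n z ≤ dAct f β m n (z m) (z n)) :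
    pathCost f β m' n' z = dAct f β m' n' (z m') (z n') := by
  refine le_antisymm ?_ (dAct_le_pathCost ..)
  obtain ⟨y, hym, hyn, hy⟩ := exists_pathCost_eq f β hmn (z m') (z n')
  rw [← hy]
  let x : ℤ → X := fun j => if m' ≤ j ∧ j ≤ n' then y j else z j
  have e₁ : pathCost f β m m' x = pathCost f β m m' z :=
    pathCost_congr (fun _ _ _ => rfl) fun j _ hj => by
      simp only [x]
      split_ifs with hc
      · rw [le_antisymm hj hc.1, hym]
      · rfl
  have e₂ : pathCost f β m' n' x = pathCost f β m' n' y :=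
    pathCost_congr (fun _ _ _ => rfl) fun j hj hj' => by simp [x, hj, hj']
  have e₃ : pathCost f β n' n x = pathCost f β n' n z :=
    pathCost_congr (fun _ _ _ => rfl) fun j hj _ => by
      simp only [x]
      split_ifs with hc
      · rw [le_antisymm hc.2 hj, hyn]
      · rfl
  have hx₁ : x m = z m := by
    simp only [x]
    split_ifs with hc
    · rw [le_antisymm hm hc.1, hym]
    · rfl
  have hx₂ : x n = z n := by
    simp only [x]
    split_ifs with hc
    · rw [le_antisymm hc.2 hn, hyn]
    · rfl
  have hle := dAct_le_pathCost f β m n x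
  rw [hx₁, hx₂, pathCost_add f β hm (hmn.le.trans hn), pathCost_add f β hmn.le hn, e₁, e₂, e₃] at hle
  rw [pathCost_add f β hm (hmn.le.trans hn), pathCost_add f β hmn.le hn] at h
  linarith

/-- There is a path which is minimizing on every interval. -/
theorem exists_global_minimizing_path {X : Type*} [SeminormedAddCommGroup X] [CompactSpace X]
    (f : ℤ → C(X, ℝ)) (β : X) : ∃ z : ℤ → X, ∀ m n : ℤ, m < n →
      pathCost f β m n z = dAct f β m n (z m) (z n) := by
  let Z : ℕ → Set (ℤ → X) := fun k => {z | pathCost f β (-(k + 1)) (k + 1) z ≤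
    dAct f β (-(k + 1)) (k + 1) (z (-(k + 1))) (z (k + 1))}
  have hcl : ∀ k, IsClosed (Z k) := fun k => isClosed_le
    (continuous_const.pathCost continuous_id β _ _)
    (continuous_const.dAct (continuous_apply _) (continuous_apply _) β (by omega))
  -- Minimality passes to subintervals, so the `Z k` are nested nonempty closed subsets of the
  -- compact path space.
  have hne : (⋂ k, Z k).Nonempty := by
    refine IsCompact.nonempty_iInter_of_sequence_nonempty_isCompact_isClosed Z (fun k z hz => ?_)
      (fun k => ?_) (hcl 0).isCompact hcl
    · exact (pathCost_eq_dAct_of_subinterval (by push_cast; omega) (by omega)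
        (by push_cast; omega) hz).le
    · obtain ⟨z, h₁, h₂, hz⟩ := exists_pathCost_eq f β
        (by omega : -((k : ℤ) + 1) < k + 1) (0 : X) (0 : X)
      refine ⟨z, ?_⟩
      simp only [Z, mem_ofPred_eq]
      rw [h₁, h₂, hz]
  obtain ⟨z, hz⟩ := hne
  refine ⟨z, fun m n hmn => ?_⟩
  have := mem_iInter.1 hz (m.natAbs + n.natAbs)
  exact pathCost_eq_dAct_of_subinterval (by omega) hmn (by omega) this

section GlobalMinimizers

variable {d : ℕ} {f : ℤ → C(Torus d, ℝ)} {b : E d}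

theorem exists_isGlobalMinimizer (f : ℤ → C(Torus d, ℝ)) (b : E d) :
    ∃ x v, IsGlobalMinimizer (fun j => f j) b x v := by
  obtain ⟨z, hz⟩ := exists_global_minimizing_path f (proj b)
  obtain ⟨p, w, hp, hw⟩ := exists_interp_lift b z
  exact ⟨z, fun j => w (j - 1), interp p w, isMinimizingCurve_interp f b hz hp hw,
    fun j => ⟨(hp j).symm, hasDerivWithinAt_interp p w j⟩⟩

theorem IsMinimizingCurve.shifted_dAct_add_le {g : ℝ → E d} {m k n : ℤ} (hmk : m < k) (hkn : k < n)
    (hg : IsMinimizingCurve (fun j => f j) b (Icc (m : ℝ) n) g) (x : Torus d) :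
    dAct (fun j => f (j + k)) (proj b) (m - k) 0 (proj (g m)) (proj (g k)) +
        dAct (fun j => f (j + k)) (proj b) 0 (n - k) (proj (g k)) (proj (g n)) ≤
      dAct (fun j => f (j + k)) (proj b) (m - k) 0 (proj (g m)) x +
        dAct (fun j => f (j + k)) (proj b) 0 (n - k) x (proj (g n)) := by
  simp only [← dAct_shift, sub_add_cancel, zero_add]
  exact hg.dAct_add_le hmk hkn x

theorem Localized.norm_proj_sub_le {n : ℕ} {r : ℝ} {k : ℤ}
    (h : Localized (fun j => f (j + k)) (proj b) n r) {g₁ g₂ : ℝ → E d} {m₁ n₁ m₂ n₂ : ℤ}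
    (hm₁ : m₁ ≤ k - (n + 1)) (hn₁ : k + (n + 1) ≤ n₁) (hm₂ : m₂ ≤ k - (n + 1))
    (hn₂ : k + (n + 1) ≤ n₂)
    (h₁ : IsMinimizingCurve (fun j => f j) b (Icc (m₁ : ℝ) n₁) g₁)
    (h₂ : IsMinimizingCurve (fun j => f j) b (Icc (m₂ : ℝ) n₂) g₂) :
    ‖proj (g₁ k) - proj (g₂ k)‖ ≤ r :=
  h.norm_sub_le (m₁ := m₁ - k) (n₁ := n₁ - k) (m₂ := m₂ - k) (n₂ := n₂ - k) (by omega) (by omega)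
    (by omega) (by omega) (h₁.shifted_dAct_add_le (by omega) (by omega))
    (h₂.shifted_dAct_add_le (by omega) (by omega))

/-- Localization at every time and scale identifies the positions. Shortest increments need not be
unique on the torus, so the velocities require the first order condition at an interior time. -/
theorem IsGlobalMinimizer.unique (hf : ∀ j, Differentiable ℝ (lift (f j)))
    (hloc : ∀ k : ℤ, ∀ r > 0, ∃ n, Localized (fun j => f (j + k)) (proj b) n r)
    {x x' : ℤ → Torus d} {v v' : ℤ → E d} (h : IsGlobalMinimizer (fun j => f j) b x v)
    (h' : IsGlobalMinimizer (fun j => f j) b x' v') : x' = x ∧ v' = v := by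
  obtain ⟨g, hg, hx⟩ := h
  obtain ⟨g', hg', hx'⟩ := h'
  have hpos : ∀ k : ℤ, proj (g' k) = proj (g k) := by
    intro k
    refine eq_of_norm_sub_eq_zero (le_antisymm ?_ (norm_nonneg _))
    refine le_of_forall_pos_le_add fun r hr => ?_
    obtain ⟨n, hn⟩ := hloc k r hr
    rw [zero_add]
    exact hn.norm_proj_sub_le (m₁ := k - (n + 1)) (n₁ := k + (n + 1)) (m₂ := k - (n + 1))
      (n₂ := k + (n + 1)) le_rfl le_rfl le_rfl le_rfl (hg'.mono (subset_univ _))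
      (hg.mono (subset_univ _))
  refine ⟨funext fun k => ?_, funext fun k => ?_⟩
  · rw [(hx k).1, (hx' k).1, hpos]
  · obtain ⟨j, rfl⟩ : ∃ j, k = j + 1 := ⟨k - 1, by omega⟩
    obtain ⟨hv, hvn⟩ := (hg.mono (subset_univ _)).velocity (f := f) (hx (j + 1)).2
    obtain ⟨hv', hvn'⟩ := (hg'.mono (subset_univ _)).velocity (f := f) (hx' (j + 1)).2
    -- One outgoing velocity suffices: both incoming velocities are compared with it.
    obtain ⟨hw, hwn⟩ := (hg.mono (subset_univ _)).velocity (f := f) (hx (j + 1 + 1)).2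
    rw [hpos, hpos] at hvn'
    have hmin := (hg.mono (subset_univ _)).dAct_add_le (f := f) (m := j) (k := j + 1)
      (n := j + 1 + 1) (by omega) (by omega)
    simp only [dAct_succ, stepCost] at hmin
    refine velocity_unique (hf (j + 1)) (x₀ := proj (g j)) (x₁ := proj (g (j + 1 : ℤ)))
      (x₂ := proj (g (j + 1 + 1 : ℤ))) (w := v (j + 1 + 1)) (fun y => ?_) ?_ hvn' ?_ hvn ?_ hwn
    · linarith [hmin y]
    · rw [hv', proj_sub, hpos, hpos]
    · rw [hv, proj_sub]
    · rw [hw, proj_sub]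

end GlobalMinimizers

/-! ### The random potentials -/

theorem enorm_le_holderNorm {d : ℕ} (α : ℝ) (h : Torus d → ℝ) (x : Torus d) :
    ‖h x‖ₑ ≤ holderNorm α h := by
  obtain ⟨w, rfl⟩ := proj_surjective x
  have h0 : ‖h (proj w)‖ₑ = ‖iteratedFDeriv ℝ 0 (lift h) w‖ₑ := by
    rw [← ofReal_norm, ← ofReal_norm, norm_iteratedFDeriv_zero]
    rfl
  rw [h0]
  refine (le_iSup (fun w => ‖iteratedFDeriv ℝ 0 (lift h) w‖ₑ) w).trans ?_
  refine le_trans ?_ (le_add_of_nonneg_right (zero_le))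
  exact Finset.single_le_sum (f := fun k => ⨆ w : E d, ‖iteratedFDeriv ℝ k (lift h) w‖ₑ)
    (fun _ _ => zero_le) (Finset.mem_range.2 (by norm_num : 0 < 3))

/-- The Hölder norm dominates the supremum norm, and the pattern argument only needs uniform
closeness. -/
theorem InSupport.mem_uniformSupport {d M : ℕ} {Ω : Type*} [MeasurableSpace Ω] {μ : Measure Ω}
    {F : Fin M → C(Torus d, ℝ)} {ξ : ℤ → Ω → Fin M → ℝ} {α : ℝ} {G : C(Torus d, ℝ)}
    (hm : Measurable (ξ 0)) (hG : InSupport μ α (fun ω => kick (fun i => F i) ξ ω 0) G) :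
    G ∈ uniformSupport (μ.map (ξ 0)) F := by
  intro ε hε
  rw [Measure.map_apply hm (measurableSet_setOf_close F G ε)]
  refine (hG.2 (ENNReal.ofReal ε) (ENNReal.ofReal_pos.2 hε)).trans_le (measure_mono ?_)
  intro ω hω x
  have := (enorm_le_holderNorm α _ x).trans (le_of_lt hω)
  rw [← ofReal_norm, ENNReal.ofReal_le_ofReal_iff hε.le] at this
  exact this

theorem InSupport.continuous {d : ℕ} {Ω : Type*} [MeasurableSpace Ω] {μ : Measure Ω} {α : ℝ}
    {X : Ω → Torus d → ℝ} {G : Torus d → ℝ} (hG : InSupport μ α X G) : Continuous G :=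
  continuous_of_continuous_lift hG.1.1.continuous

theorem exists_sep_pattern {d M : ℕ} {Ω : Type*} [MeasurableSpace Ω] {μ : Measure Ω}
    {F : Fin M → C(Torus d, ℝ)} {ξ : ℤ → Ω → Fin M → ℝ} {α : ℝ} (hm : Measurable (ξ 0))
    (h : Assumption1 μ α (fun ω => kick (fun i => F i) ξ ω 0) ∨
      Assumption2 μ α (fun ω => kick (fun i => F i) ξ ω 0)) (β : Torus d) :
    ∀ ε > 0, ∃ (N : ℕ) (g : ℤ → C(Torus d, ℝ)), 0 < N ∧
      (∀ j, g j ∈ uniformSupport (μ.map (ξ 0)) F) ∧ Sep (dAct g β 0 N) ε := by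
  intro ε hε
  rcases h with h | h
  · refine exists_sep_pattern_of_maxima β (fun y => ?_) hε
    obtain ⟨G, hG, -, δ, hδ, hmax⟩ := h y
    exact ⟨⟨G, hG.continuous⟩, InSupport.mem_uniformSupport hm hG, δ, hδ, hmax⟩
  · exact exists_sep_pattern_of_zero β (InSupport.mem_uniformSupport (G := 0) hm h)
      exists_nsmul_eq_norm_le hε

theorem exists_measurable_nat_choice {Ω : Type*} [MeasurableSpace Ω] {p : Ω → ℕ → Prop}
    (hp : ∀ n, MeasurableSet {ω | p ω n}) :
    ∃ N : Ω → ℕ, Measurable N ∧ ∀ ω, (∃ n, p ω n) → p ω (N ω) := by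
  classical
  -- The second alternative makes the search for the least index terminate for every `ω`.
  let q : Ω → ℕ → Prop := fun ω n => p ω n ∨ ¬∃ k, p ω k
  have hq : ∀ ω, ∃ n, q ω n := fun ω => by
    by_cases h : ∃ k, p ω k
    · exact h.imp fun n hn => Or.inl hn
    · exact ⟨0, Or.inr h⟩
  refine ⟨fun ω => Nat.find (hq ω), measurable_find hq fun n => ?_, fun ω h => ?_⟩
  · have : {ω | q ω n} = {ω | p ω n} ∪ (⋃ k, {ω | p ω k})ᶜ := by
      ext ω
      simp [q]
    rw [this]
    exact (hp n).union (MeasurableSet.iUnion hp).compl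
  · exact (Nat.find_spec (hq ω)).resolve_right (not_not.2 h)

end KickedHJ
end

theorem proposition5p2 {d M : ℕ} {Ω : Type*} [MeasurableSpace Ω]
    (μ : Measure Ω) [IsProbabilityMeasure μ]
    (F : Fin M → KickedHJ.Torus d → ℝ) (ξ : ℤ → Ω → Fin M → ℝ) (r : (Fin M → ℝ) → ℝ)
    (α : ℝ) (hα : 0 < α) (hα1 : α ≤ 1)
    (h5 : KickedHJ.Assumption5 μ F ξ r)
    (h12 : KickedHJ.Assumption1 μ α (fun ω => KickedHJ.kick F ξ ω 0) ∨
      KickedHJ.Assumption2 μ α (fun ω => KickedHJ.kick F ξ ω 0))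
    (hF : IsEmbedding (fun (x : KickedHJ.Torus d) (i : Fin M) => F i x))
    (b : KickedHJ.E d)
    (R : Ω → ℝ) (hR : Measurable R) (hRpos : ∀ᵐ ω ∂μ, 0 < R ω) :
    ∃ M₀ : Ω → ℕ, Measurable M₀ ∧ ∀ᵐ ω ∂μ,
      ∃ (x : ℤ → KickedHJ.Torus d) (v : ℤ → KickedHJ.E d),
        KickedHJ.IsGlobalMinimizer (KickedHJ.kick F ξ ω) b x v ∧
        (∀ (x' : ℤ → KickedHJ.Torus d) (v' : ℤ → KickedHJ.E d),
          KickedHJ.IsGlobalMinimizer (KickedHJ.kick F ξ ω) b x' v' → x' = x ∧ v' = v) ∧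
        ∀ N T : ℕ, M₀ ω ≤ N → M₀ ω ≤ T → ∀ φ : C(KickedHJ.Torus d, ℝ),
          (∀ (y : ℤ → KickedHJ.Torus d) (η : ℤ → KickedHJ.E d),
            KickedHJ.IsBackwardMinimizerFor (KickedHJ.kick F ξ ω) b (-(N : ℤ)) T φ y η →
              ‖y 0 - x 0‖ < R ω) ∧
          (∀ (y : ℤ → KickedHJ.Torus d) (η : ℤ → KickedHJ.E d),
            KickedHJ.IsForwardMinimizerFor (KickedHJ.kick F ξ ω) b (-(N : ℤ)) T φ y η →
              ‖y 0 - x 0‖ < R ω) := by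
  have hFc : ∀ i, Continuous (F i) := fun i =>
    KickedHJ.continuous_of_continuous_lift (h5.smooth i).continuous
  obtain ⟨Fc, rfl⟩ : ∃ Fc : Fin M → C(KickedHJ.Torus d, ℝ), F = fun i => ⇑(Fc i) :=
    ⟨fun i => ⟨F i, hFc i⟩, rfl⟩
  let f : Ω → ℤ → C(KickedHJ.Torus d, ℝ) := fun ω => KickedHJ.kickC Fc fun j => ξ j ω
  have hkick : ∀ ω, KickedHJ.kick (fun i => ⇑(Fc i)) ξ ω = fun j => ⇑(f ω j) := fun ω => by
    funext j x
    simp [KickedHJ.kick, f, KickedHJ.kickC]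
  have hdiff : ∀ ω j, Differentiable ℝ (KickedHJ.lift (f ω j)) := fun ω j => by
    have hsum : KickedHJ.lift (f ω j) = fun w => ∑ i, ξ j ω i * KickedHJ.lift (Fc i) w := by
      funext w
      simp [KickedHJ.lift, f, KickedHJ.kickC]
    rw [hsum]
    exact Differentiable.fun_sum fun i _ =>
      ((h5.smooth i).differentiable (by simp)).const_mul _
  have hlaw : ∀ j, μ.map (ξ j) = μ.map (ξ 0) := fun j => (h5.law j).trans (h5.law 0).symm
  have hac : μ.map (ξ 0) ≪ volume := by
    rw [h5.law 0]
    exact withDensity_absolutelyContinuous _ _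
  have hloc := KickedHJ.ae_forall_exists_localized h5.measurable h5.indep hlaw hac hF.injective
    (KickedHJ.proj b) (KickedHJ.exists_sep_pattern (h5.measurable 0) h12 (KickedHJ.proj b))
  -- Half of the random radius leaves room for the strict inequality.
  obtain ⟨N₀, hN₀, hfind⟩ := KickedHJ.exists_measurable_nat_choice
    (p := fun ω n => KickedHJ.Localized (f ω) (KickedHJ.proj b) n (R ω / 2)) fun n =>
      KickedHJ.measurableSet_localized_comp (KickedHJ.continuous_kickC Fc)
        (measurable_pi_iff.2 h5.measurable) (hR.div_const 2) (KickedHJ.proj b) n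
  -- Localization with index `n` uses the window `[-(n + 1), n + 1]`.
  refine ⟨fun ω => N₀ ω + 1, hN₀.add_const 1, ?_⟩
  filter_upwards [hloc, hRpos] with ω hω hRω
  rw [hkick]
  obtain ⟨x, v, hx⟩ := KickedHJ.exists_isGlobalMinimizer (f ω) b
  refine ⟨x, v, hx, fun x' v' hx' => hx.unique (hdiff ω) hω hx', ?_⟩
  have hR₀ := hfind ω (by simpa using hω 0 (R ω / 2) (by positivity))
  obtain ⟨g, hg, hgx⟩ := hx
  have key : ∀ N T : ℕ, N₀ ω + 1 ≤ N → N₀ ω + 1 ≤ T → ∀ (y : ℤ → KickedHJ.Torus d)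
      (η : ℤ → KickedHJ.E d), KickedHJ.IsMinimizer (fun j => f ω j) b (-(N : ℤ)) T y η →
        ‖y 0 - x 0‖ < R ω := by
    rintro N T hN hT y η ⟨⟨g', hg', hy, -⟩, -⟩
    rw [hy 0 (by omega) (by omega), (hgx 0).1]
    refine lt_of_le_of_lt ?_ (half_lt_self hRω)
    exact KickedHJ.Localized.norm_proj_sub_le (f := f ω) (k := 0) (m₂ := -N) (n₂ := T)
      (by simpa using hR₀) (by omega) (by omega) (by omega) (by omega) hg'
      (hg.mono (subset_univ _))
  exact fun N T hN hT φ => ⟨fun y η h => key N T hN hT y η h.1, fun y η h => key N T hN hT y η h.1⟩
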